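/- Consider a channel divided into slots, shared by two saturated users that follow CSMA/CA with binary exponential backoff in RTS/CTS mode. The parameters are an integer $\mathrm{CW}_{\min}\ge 1$, an integer $\beta\ge 0$ and durations $T_{\text{slot}},\ell_{\text{difs}},\ell_{\text{pkt}},\ell_{\text{ack}},\ell_{\text{rts}},\ell_{\text{cts}}\ge 0$. Put $\mathrm{CW}_{\max}=2^{\beta}\mathrm{CW}_{\min}$, $\mathrm{CW}_i=\min\{2^i\mathrm{CW}_{\min},\mathrm{CW}_{\max}\}$, $\ell_{\text{tran}}=\ell_{\text{pkt}}+\ell_{\text{ack}}$, $\ell_{\text{rcts}}=\ell_{\text{rts}}+\ell_{\text{cts}}$, $\ell_{\text{nav}}=\ell_{\text{tran}}+\ell_{\text{rcts}}-T_{\text{slot}}$, and assume $\mathrm{CW}_{\max}\ge 2$. *Protocol.* A user transmits in a slot exactly when its backoff counter is $0$, and otherwise decrements the counter by one. After $i$ collisions of the current packet (initially $i=0$, and $i=0$ again for the next packet after a success), it draws a new counter uniformly from $\{1,\dots,\mathrm{CW}_i\}$. A slot in which nobody transmits lasts $T_{\text{slot}}$; a slot in which both transmit (collision) lasts $\ell_{\text{rcts}}$;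 a slot in which exactly one user transmits (a success of that user) lasts $\ell_{\text{rcts}}+\ell_{\text{tran}}$. A DIFS of length $\ell_{\text{difs}}$ elapses before the first slot and after every busy slot. Following Bianchi's decoupling approximation, the channel is described from the point of view of each user, as follows: the other user transmits in each slot with a fixed probability $p$, independently of everything else. The collision probability $p_c$ is a $p\in[0,1]$ that is self-consistent: the backoff Markov chain (stage, counter) of a user whose transmissions each collide with probability $p$ has a stationary distribution under which the user transmits in a slot with probability $\tau=p$ (that is, $p=1-(1-\tau)^{2-1}$). *Cycle times.* A refresh moment of a user is the end of a successful access of that user such that the next successful access belongs to another user. If $t_0<t_1$ are refresh moments of a user, then $t_1-t_0$ is a cycle time of this user if every user completes at least one successful access in $(t_0,t_1]$ and, in case $t_0,t_1$ are not consecutive refresh moments of the user, this is not so for $(t_0,t']$, where $t'\in(t_0,t_1)$ is the refresh moment of the user closest to $t_1$. Let $\Gamma_u$ be a cycle time of user $u$ (the one that starts at the $k$-th refresh moment of $u$, for any $k$), and let the channel cycle time be $\Psi_{\text{CSMA/CA}}=\frac12\sum_{u}\mathbb E[\Gamma_u]$. The number $N_I$ of inter-transmissions is the number of successful accesses of the other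 user between two consecutive successful accesses of a user, and $P_{N_I,n}=\Pr(N_I=n)$. **Theorem.** The collision probability $p_c$ exists and is unique. It satisfies $$p_c=\frac{2(1-2p_c)}{(1-2p_c)(\mathrm{CW}_{\min}+3)+p_c\,\mathrm{CW}_{\min}\,[1-(2p_c)^{\beta}]},$$ and this equation has a unique solution in $[0,1]$ (solutions being required to have a non-zero denominator). In this network, almost surely each user has infinitely many refresh moments, and each of them starts exactly one cycle time; the cycle times are integrable; the distribution of $N_I$ is the same for both users and for every pair of consecutive successes, with $P_{N_I,0}<1$; and for every $k$ $$\Psi_{\text{CSMA/CA}}=\frac{1}{1-P_{N_I,0}}\left[\ell_{\text{difs}}+\ell_{\text{nav}}+\ell_{\text{tran}}+\frac{\ell_{\text{difs}}+\ell_{\text{rcts}}}{1-p_c}+T_{\text{slot}}\left(\sum_{i=0}^{\beta-1}p_c^i\,\frac{1+2^i\mathrm{CW}_{\min}}{2}+\frac{p_c^{\beta}}{1-p_c}\cdot\frac{1+2^{\beta}\mathrm{CW}_{\min}}{2}\right)\right].$$ In particular, if durations are measured in units of a slot ($T_{\text{slot}}=1$), the factor $T_{\text{slot}}$ disappears. 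-/

import Mathlib

open MeasureTheory ProbabilityTheory

noncomputable section

/-! ### Slotted channel traces, refresh moments and cycle times for an arbitrary set of users -/

/-- What happens on the shared channel during one (variable length) slot. -/
inductive SlotOutcome (ι : Type) : Type where
  | idle : SlotOutcome ι
  | success (user : ι) : SlotOutcome ι
  | collision : SlotOutcome ι

namespace Channel

variable {ι : Type}

/-- The end of slot `t` is a refresh moment of user `i`: a successful channel access of user `i`
ends there, and the next successful channel access belongs to another user. -/
def IsRefresh (e : ℕ → SlotOutcome ι) (i : ι) (t : ℕ) : Prop :=
  e t = .success i ∧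
    ∃ s, t < s ∧ (∃ j, j ≠ i ∧ e s = .success j) ∧ ∀ r, t < r → r < s → ∀ j, e r ≠ .success j

/-- The number of successful channel accesses of user `n` that end after the end of slot `t` and
not later than the end of slot `t'`. -/
def numSuccess (e : ℕ → SlotOutcome ι) (n : ι) (t t' : ℕ) : ℕ :=
  Set.ncard {s : ℕ | t < s ∧ s ≤ t' ∧ e s = .success n}

/-- The time between the ends of the slots `t₀ < t₁` is a cycle time of user `i`. Both are refresh
moments of `i`, all users have accessed the channel in between, and, if they are not consecutive
refresh moments of `i`, this fails when `t₁` is replaced by the refresh moment of `i` strictly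
between `t₀` and `t₁` that is closest to `t₁`. -/
def IsCycle (e : ℕ → SlotOutcome ι) (i : ι) (t₀ t₁ : ℕ) : Prop :=
  IsRefresh e i t₀ ∧ IsRefresh e i t₁ ∧ t₀ < t₁ ∧ (∀ n, 0 < numSuccess e n t₀ t₁) ∧
    ((∀ s, t₀ < s → s < t₁ → ¬ IsRefresh e i s) ∨
      ∃ t', t₀ < t' ∧ t' < t₁ ∧ IsRefresh e i t' ∧ (∀ s, t' < s → s < t₁ → ¬ IsRefresh e i s) ∧
        ∃ n, numSuccess e n t₀ t' = 0)

/-- The slot at whose end the cycle of user `i` that starts at the end of slot `t₀` is over. -/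
def cycleEnd (e : ℕ → SlotOutcome ι) (i : ι) (t₀ : ℕ) : ℕ :=
  sInf {t₁ | IsCycle e i t₀ t₁}

/-- The slot of the `j`-th (from `0`) successful channel access of user `i`. -/
def successSlot (e : ℕ → SlotOutcome ι) (i : ι) (j : ℕ) : ℕ :=
  Nat.nth (fun t => e t = .success i) j

/-- The slot at whose end the `k`-th (from `0`) refresh moment of user `i` takes place. -/
def refreshSlot (e : ℕ → SlotOutcome ι) (i : ι) (k : ℕ) : ℕ :=
  Nat.nth (IsRefresh e i) k

/-- The number of inter-transmissions: successful channel accesses of the other users between the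
`j`-th and the `(j+1)`-st successful channel access of user `i`. -/
def interTrans (e : ℕ → SlotOutcome ι) (i : ι) (j : ℕ) : ℕ :=
  Set.ncard {s : ℕ | successSlot e i j < s ∧ s < successSlot e i (j + 1) ∧
    ∃ n, n ≠ i ∧ e s = .success n}

end Channel

/-! ### Two-user saturated CSMA/CA in RTS/CTS mode -/

/-- Parameters of the protocol. -/
structure CSMA where
  /-- minimum contention window size `CW_min` -/
  CWmin : ℕ
  CWmin_pos : 0 < CWmin
  /-- number of possible doublings of the contention window -/
  β : ℕ
  /-- duration of an idle backoff slot -/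
  Tslot : ℝ
  difs : ℝ
  pkt : ℝ
  ack : ℝ
  rts : ℝ
  cts : ℝ
  Tslot_nonneg : 0 ≤ Tslot
  difs_nonneg : 0 ≤ difs
  pkt_nonneg : 0 ≤ pkt
  ack_nonneg : 0 ≤ ack
  rts_nonneg : 0 ≤ rts
  cts_nonneg : 0 ≤ cts

namespace CSMA

variable (c : CSMA)

/-- duration of a data packet with its acknowledgement -/
def tran : ℝ := c.pkt + c.ack

/-- duration of the RTS/CTS handshake -/
def rcts : ℝ := c.rts + c.cts

/-- duration of the network allocation vector -/
def nav : ℝ := c.tran + c.rcts - c.Tslot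

/-- maximum contention window size `CW_max` -/
def CWmax : ℕ := 2 ^ c.β * c.CWmin

/-- contention window size after `i` collisions of the current packet -/
def cw (i : ℕ) : ℕ := min (2 ^ i * c.CWmin) c.CWmax

/-- Time at which slot `t` ends when the channel trace is `e`. An idle slot takes `Tslot`, a
collision takes an RTS/CTS exchange, a successful access takes an RTS/CTS exchange and the
transmission of the packet. A DIFS elapses before the first slot and after every busy slot. -/
def endTime {ι : Type} (e : ℕ → SlotOutcome ι) : ℕ → ℝ
  | 0 => c.difs + body (e 0)
  | t + 1 => endTime e t + gap (e t) + body (e (t + 1))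
where
  /-- length of the slot itself -/
  body : SlotOutcome ι → ℝ
    | .idle => c.Tslot
    | .success _ => c.rcts + c.tran
    | .collision => c.rcts
  /-- length of the inter-frame space that follows the slot -/
  gap : SlotOutcome ι → ℝ
    | .idle => 0
    | .success _ => c.difs
    | .collision => c.difs

/-- The state of a user: the backoff stage (the number of collisions of the current packet, capped
at `β`, beyond which the window no longer grows) and the current value of the backoff counter. -/
abbrev State : Type := Fin (c.β + 1) × ℕ

/-- The randomness of one slot from the point of view of one user: whether the other user transmits
in the slot, and, for every backoff stage, the counter that the user would draw at the end of the
slot if it had to draw one in that stage. -/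
abbrev Noise : Type := Bool × (Fin (c.β + 1) → ℕ)

/-- The next backoff stage after a collision. -/
def nextStage (i : Fin (c.β + 1)) : Fin (c.β + 1) :=
  ⟨min (i + 1) c.β, Nat.lt_succ_of_le (min_le_right _ _)⟩

/-- One step of the backoff process of a saturated user. The user transmits in the slot iff its
counter is `0`; then it draws a new counter, in the next stage if there was a collision and in stage
`0` (for the next packet) otherwise. If the counter is positive, it is decremented. -/
def step (x : c.State) (ξ : c.Noise) : c.State :=
  if x.2 = 0 then
    let i := if ξ.1 then c.nextStage x.1 else 0
    (i, ξ.2 i)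
  else (x.1, x.2 - 1)

/-- The decoupling model: in each slot the other user transmits with probability `p`; a counter
drawn in stage `i` is uniform on `{1, …, CW_i}`. -/
def noiseLaw (p : unitInterval) : Measure c.Noise :=
  (bernoulliMeasure true false p).prod (Measure.pi fun i => uniformOn (Set.Icc 1 (c.cw i)))

/-- The noise of different slots is independent. The first entry only serves to draw the initial
counter; the entry with index `t + 1` belongs to slot `t`. -/
def law (p : unitInterval) : Measure (ℕ → c.Noise) :=
  Measure.infinitePi fun _ => c.noiseLaw p

lemma cw_pos (i : ℕ) : 0 < c.cw i :=
  lt_min (Nat.mul_pos (by positivity) c.CWmin_pos) (Nat.mul_pos (by positivity) c.CWmin_pos)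

instance (i : ℕ) : IsProbabilityMeasure (uniformOn (Set.Icc 1 (c.cw i))) :=
  isProbabilityMeasure_uniformOn (Set.finite_Icc _ _) ⟨1, le_refl _, c.cw_pos i⟩

instance (p : unitInterval) : IsProbabilityMeasure (c.noiseLaw p) := by
  unfold noiseLaw; infer_instance

instance (p : unitInterval) : IsProbabilityMeasure (c.law p) := by
  unfold law; infer_instance

/-- State of the user at the beginning of slot `t`. -/
def state (ω : ℕ → c.Noise) : ℕ → c.State
  | 0 => (0, (ω 0).2 0)
  | t + 1 => c.step (state ω t) (ω (t + 1))

/-- The channel as seen by user `u` of the two users `0` and `1`; the other user is `1 - u`. -/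
def trace (u : Fin 2) (ω : ℕ → c.Noise) (t : ℕ) : SlotOutcome (Fin 2) :=
  if (c.state ω t).2 = 0 then
    if (ω (t + 1)).1 then .collision else .success u
  else
    if (ω (t + 1)).1 then .success (1 - u) else .idle

/-- `p` is the collision probability of the network: if each transmission collides with
probability `p`, the backoff chain of a user has a stationary distribution for which the probability
`τ` that the user transmits in a slot satisfies `p = 1 - (1 - τ) ^ (2 - 1)`, that is, `p` is the
probability that the only other user transmits. -/
def IsCollisionProb (p : unitInterval) : Prop :=
  ∃ π : Measure c.State, IsProbabilityMeasure π ∧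
    (π.prod (c.noiseLaw p)).map (fun z => c.step z.1 z.2) = π ∧
    (p : ℝ) = 1 - (1 - π.real {x | x.2 = 0}) ^ (2 - 1)

/-- `p` solves the recursive equation of the collision probability (with a meaningful quotient). -/
def SolvesRecursion (p : ℝ) : Prop :=
  (1 - 2 * p) * (c.CWmin + 3) + p * c.CWmin * (1 - (2 * p) ^ c.β) ≠ 0 ∧
    p = 2 * (1 - 2 * p) /
      ((1 - 2 * p) * (c.CWmin + 3) + p * c.CWmin * (1 - (2 * p) ^ c.β))

/-- The `k`-th cycle time of user `u`: the one that starts at the `k`-th refresh moment. -/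
def cycleTime (u : Fin 2) (k : ℕ) (ω : ℕ → c.Noise) : ℝ :=
  c.endTime (c.trace u ω)
      (Channel.cycleEnd (c.trace u ω) u (Channel.refreshSlot (c.trace u ω) u k)) -
    c.endTime (c.trace u ω) (Channel.refreshSlot (c.trace u ω) u k)

/-- The channel cycle time: the expected (`k`-th) cycle time averaged over both users. -/
def channelCycleTime (p : unitInterval) (k : ℕ) : ℝ :=
  (1 / 2) * ∑ u : Fin 2, ∫ ω, c.cycleTime u k ω ∂(c.law p)

end CSMA

end

/-! A renewal argument for the cycle times is combined with an analysis of one backoff chain.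

Cycle times. With two users every cycle of `u` runs from one refresh moment of `u` to the next
(`isCycle_iff`). After each success of `u` its backoff restarts in stage 0 with fresh noise, so the
trace regenerates (`isRenewal_traceLaw`). Let S be the cost up to the first success of `u`, R the
cost up to its first refresh moment, and D the event that the other user succeeds first. The first
success of `u` is a refresh moment exactly if D holds for the trace behind it, so E R = E S + E[R;
Dᶜ]. Once E[R; Dᶜ] is known to be finite, E[R; D] = E S (`IsRenewal.setLIntegral_refreshCost`). A
cycle is R under the law conditioned on D, so its mean is E S / P(D), where P(D) = 1 - P(N_I = 0).
The number of successes in a cycle need not be independent of their durations.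

The mean of S. An explicit function of the state, affine in the counter, solves the one-step
equation (`isValue_value`). Iterating this equation leaves a remainder that vanishes
(`IsValue.lintegral_successCost_eq`), which gives E S = `waitCost` * B + `accessCost` / (1 - p) with
B = `meanBackoff p 0`.

Collision probability. A stationary law gives (i, n) the mass (rate of entering stage i) * P(draw ≥
n). Total mass 1 and `sum_mul_meanCounter` turn self-consistency into p (1 + (1 - p) B) = 1, that
is, `balance p = 2`. The recursive equation becomes the same condition when 1 - 2p is cancelled
(`solvesRecursion_iff`), and `balance` is strictly increasing. The condition also says p B = 1,
which brings E S into the stated form. -/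

noncomputable section

/-! ### Enumeration of infinite sets of natural numbers -/

namespace Nat

lemma nth_succ_spec {q : ℕ → Prop} (hq : {n | q n}.Infinite) (k : ℕ) :
    q (nth q (k + 1)) ∧ nth q k < nth q (k + 1) ∧
      ∀ r, nth q k < r → r < nth q (k + 1) → ¬ q r :=
  ⟨nth_mem_of_infinite hq _, nth_strictMono hq k.lt_succ_self, fun _ h₁ h₂ hr =>
    (le_nth_of_lt_nth_succ h₂ hr).not_gt h₁⟩

open Classical in
lemma nth_eq_iff_count_eq {q : ℕ → Prop} (hq : {n | q n}.Infinite) (k t : ℕ) :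
    nth q k = t ↔ q t ∧ count q t = k := by
  constructor
  · rintro rfl
    exact ⟨nth_mem_of_infinite hq _, count_nth_of_infinite hq _⟩
  · rintro ⟨h, rfl⟩
    exact nth_count h

lemma exists_minimal_of_exists {q : ℕ → Prop} (h : ∃ n, q n) : ∃ n, q n ∧ ∀ r < n, ¬ q r := by
  classical
  exact ⟨Nat.find h, Nat.find_spec h, fun r hr => Nat.find_min h hr⟩

end Nat

/-! ### Refresh moments and cycles of a fixed trace -/

namespace Channel

variable {ι : Type}

/-- The trace seen from slot `n` on. -/
def shift (n : ℕ) (e : ℕ → SlotOutcome ι) : ℕ → SlotOutcome ι := fun t => e (n + t)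

/-- The first successful access belongs to a user other than `i`. -/
def OtherFirst (i : ι) (e : ℕ → SlotOutcome ι) : Prop :=
  ∃ s, (∃ j, j ≠ i ∧ e s = .success j) ∧ ∀ r < s, ∀ j, e r ≠ .success j

/-- The number of successful accesses of other users before the first one of user `i`. -/
def precedingOthers (i : ι) (e : ℕ → SlotOutcome ι) : ℕ :=
  Set.ncard {s | (∀ r ≤ s, e r ≠ .success i) ∧ ∃ n, n ≠ i ∧ e s = .success n}

lemma isRefresh_iff (e : ℕ → SlotOutcome ι) (i : ι) (t : ℕ) :
    IsRefresh e i t ↔ e t = .success i ∧ OtherFirst i (shift (t + 1) e) := by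
  refine and_congr_right fun _ => ⟨?_, ?_⟩
  · rintro ⟨s, hs, hj, hr⟩
    obtain ⟨m, rfl⟩ := Nat.exists_eq_add_of_lt hs
    refine ⟨m, by simpa [shift, add_right_comm] using hj, fun r hrm j => hr _ (by omega) (by omega) j⟩
  · rintro ⟨s, hj, hr⟩
    refine ⟨t + 1 + s, by omega, hj, fun r h₁ h₂ j => ?_⟩
    obtain ⟨m, rfl⟩ := Nat.exists_eq_add_of_lt h₁
    have := hr m (by omega) j
    rwa [shift, add_right_comm] at this

lemma shift_shift (m n : ℕ) (e : ℕ → SlotOutcome ι) : shift m (shift n e) = shift (n + m) e := by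
  funext t; simp [shift, add_assoc]

lemma isRefresh_shift (e : ℕ → SlotOutcome ι) (i : ι) (n t : ℕ) :
    IsRefresh (shift n e) i t ↔ IsRefresh e i (n + t) := by
  rw [isRefresh_iff, isRefresh_iff, shift_shift, add_assoc]; rfl

/-- Being a refresh moment depends on the future, but the success in slot `t` bounds how far one has
to look: whose success follows `r` is settled by then. -/
lemma isRefresh_congr {e e' : ℕ → SlotOutcome ι} {i : ι} {r t : ℕ} (h : ∀ s ≤ t, e s = e' s)
    (ht : e t = .success i) (hr : r < t) (hR : IsRefresh e i r) : IsRefresh e' i r := by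
  obtain ⟨h₁, s, hs, hj, hb⟩ := hR
  have hst : s ≤ t := not_lt.1 fun hts => hb t hr hts i ht
  refine ⟨h r hr.le ▸ h₁, s, hs, h s hst ▸ hj, fun q hq hqs j => ?_⟩
  rw [← h q (by omega)]
  exact hb q hq hqs j

open Classical in
lemma count_isRefresh_congr {e e' : ℕ → SlotOutcome ι} {i : ι} {t : ℕ} (h : ∀ s ≤ t, e s = e' s)
    (ht : e t = .success i) : Nat.count (IsRefresh e i) t = Nat.count (IsRefresh e' i) t := by
  rw [Nat.count_eq_card_filter_range, Nat.count_eq_card_filter_range]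
  congr 1
  refine Finset.filter_congr fun r hr => ?_
  rw [Finset.mem_range] at hr
  exact ⟨isRefresh_congr h ht hr, isRefresh_congr (fun s hs => (h s hs).symm) (h t le_rfl ▸ ht) hr⟩

lemma numSuccess_pos_iff {e : ℕ → SlotOutcome ι} {n : ι} {t t' : ℕ} :
    0 < numSuccess e n t t' ↔ ∃ s, t < s ∧ s ≤ t' ∧ e s = .success n := by
  rw [numSuccess, Set.ncard_pos ((Set.finite_Iic t').subset fun s hs => hs.2.1)]
  rfl

/-- The first success after `t₀` belongs to the other user, and it cannot come later than `t₁`,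
itself a success of `u`. -/
lemma numSuccess_pos {e : ℕ → SlotOutcome (Fin 2)} {u : Fin 2} {t₀ t₁ : ℕ}
    (h₀ : IsRefresh e u t₀) (h₁ : IsRefresh e u t₁) (h : t₀ < t₁) (n : Fin 2) :
    0 < numSuccess e n t₀ t₁ := by
  rw [numSuccess_pos_iff]
  by_cases hn : n = u
  · exact ⟨t₁, h, le_rfl, hn ▸ h₁.1⟩
  · obtain ⟨-, s, hs, ⟨j, hj, hes⟩, hb⟩ := h₀
    refine ⟨s, hs, not_lt.1 fun hts => hb t₁ h hts u h₁.1, ?_⟩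
    rwa [show n = j by omega]

/-- With two users, cycles lead from one refresh moment to the next. -/
lemma isCycle_iff (e : ℕ → SlotOutcome (Fin 2)) (u : Fin 2) (t₀ t₁ : ℕ) :
    IsCycle e u t₀ t₁ ↔ IsRefresh e u t₀ ∧ IsRefresh e u t₁ ∧ t₀ < t₁ ∧
      ∀ s, t₀ < s → s < t₁ → ¬ IsRefresh e u s := by
  constructor
  · rintro ⟨h₀, h₁, h, -, hc | ⟨t', ht', -, hR, -, n, hn⟩⟩
    · exact ⟨h₀, h₁, h, hc⟩
    -- A refresh moment in between has already seen successes of both users, so the second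
    -- alternative of the minimality clause is void.
    · exact absurd hn (numSuccess_pos h₀ hR ht' n).ne'
  · rintro ⟨h₀, h₁, h, hc⟩
    exact ⟨h₀, h₁, h, numSuccess_pos h₀ h₁ h, .inl hc⟩

lemma isCycle_refreshSlot_iff {e : ℕ → SlotOutcome (Fin 2)} {u : Fin 2}
    (h : {t | IsRefresh e u t}.Infinite) (k t₁ : ℕ) :
    IsCycle e u (refreshSlot e u k) t₁ ↔ t₁ = refreshSlot e u (k + 1) := by
  obtain ⟨h₁, h₂, h₃⟩ := Nat.nth_succ_spec h k
  rw [isCycle_iff]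
  constructor
  · rintro ⟨-, hR, hlt, hb⟩
    refine le_antisymm (not_lt.1 fun hl => hb _ h₂ hl h₁) (not_lt.1 fun hl => h₃ _ hlt hl hR)
  · rintro rfl
    exact ⟨Nat.nth_mem_of_infinite h k, h₁, h₂, h₃⟩

lemma existsUnique_isCycle {e : ℕ → SlotOutcome (Fin 2)} {u : Fin 2}
    (h : {t | IsRefresh e u t}.Infinite) {t₀ : ℕ} (ht : IsRefresh e u t₀) :
    ∃! t₁, IsCycle e u t₀ t₁ := by
  classical
  have ht₀ : t₀ = refreshSlot e u (Nat.count (IsRefresh e u) t₀) := (Nat.nth_count ht).symm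
  rw [ht₀]
  exact ⟨_, (isCycle_refreshSlot_iff h _ _).2 rfl, fun t₁ => (isCycle_refreshSlot_iff h _ _).1⟩

lemma cycleEnd_refreshSlot {e : ℕ → SlotOutcome (Fin 2)} {u : Fin 2}
    (h : {t | IsRefresh e u t}.Infinite) (k : ℕ) :
    cycleEnd e u (refreshSlot e u k) = refreshSlot e u (k + 1) := by
  simp only [cycleEnd, isCycle_refreshSlot_iff h, Set.ofPred_eq_eq_singleton, csInf_singleton]

/-! ### Inter-transmissions -/

lemma interTrans_eq_precedingOthers {e : ℕ → SlotOutcome ι} {i : ι}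
    (h : {t | e t = .success i}.Infinite) (j : ℕ) :
    interTrans e i j = precedingOthers i (shift (successSlot e i j + 1) e) := by
  obtain ⟨h₁, h₂, h₃⟩ := Nat.nth_succ_spec h j
  rw [interTrans, precedingOthers]
  change e (successSlot e i (j + 1)) = _ at h₁
  change successSlot e i j < successSlot e i (j + 1) at h₂
  change ∀ r, successSlot e i j < r → r < successSlot e i (j + 1) → ¬ e r = _ at h₃
  generalize successSlot e i j = a at *
  generalize successSlot e i (j + 1) = b at *
  symm
  rw [← Set.ncard_image_of_injective _ (add_right_injective (a + 1))]
  congr 1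
  ext s
  simp only [Set.mem_ofPred_eq, Set.mem_image, shift]
  constructor
  · rintro ⟨m, ⟨hm, hn⟩, rfl⟩
    refine ⟨by omega, not_le.1 fun hb => ?_, hn⟩
    refine hm (b - (a + 1)) (by omega) ?_
    rwa [Nat.add_sub_of_le (by omega)]
  · rintro ⟨has, hsb, hn⟩
    obtain ⟨m, rfl⟩ := Nat.exists_eq_add_of_lt has
    refine ⟨m, ⟨fun r hr => h₃ _ (by omega) (by omega), ?_⟩, by omega⟩
    rwa [add_right_comm]

lemma otherFirst_iff_precedingOthers_ne_zero {e : ℕ → SlotOutcome ι} {i : ι}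
    (h : ∃ t, e t = .success i) : OtherFirst i e ↔ precedingOthers i e ≠ 0 := by
  obtain ⟨t, ht⟩ := h
  have hfin : {s | (∀ r ≤ s, e r ≠ .success i) ∧ ∃ n, n ≠ i ∧ e s = .success n}.Finite :=
    (Set.finite_Iio t).subset fun s hs => not_le.1 fun hts => hs.1 t hts ht
  rw [precedingOthers, ← Nat.pos_iff_ne_zero, Set.ncard_pos hfin]
  constructor
  · rintro ⟨s, ⟨j, hj, hs⟩, hb⟩
    refine ⟨s, fun r hr => ?_, j, hj, hs⟩
    rcases hr.lt_or_eq with hr | rfl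
    · exact hb r hr i
    · rw [hs]; simpa using hj
  · rintro ⟨s, hs, hn⟩
    obtain ⟨m, ⟨j, hm⟩, hmin⟩ := Nat.exists_minimal_of_exists
      (q := fun m => ∃ j, e m = .success j) ⟨s, hn.imp fun _ h => h.2⟩
    refine ⟨m, ⟨j, ?_, hm⟩, fun r hr j hj => hmin r hr ⟨j, hj⟩⟩
    rintro rfl
    exact hs m (not_lt.1 fun hl => hmin s hl (hn.imp fun _ h => h.2)) hm

/-! ### Costs accumulated until a stopping time -/

open scoped ENNReal

/-- The sum of `g` up to and including the first index at which `q` holds. -/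
def sumUntil (q : ℕ → Prop) (g : ℕ → ℝ≥0∞) : ℝ≥0∞ := ∑' t, {t | ∀ r < t, ¬ q r}.indicator g t

lemma sumUntil_eq_sum {q : ℕ → Prop} (g : ℕ → ℝ≥0∞) {s : ℕ} (hs : q s) (hmin : ∀ r < s, ¬ q r) :
    sumUntil q g = ∑ t ∈ Finset.range (s + 1), g t := by
  rw [sumUntil, tsum_eq_sum (s := Finset.range (s + 1))]
  · refine Finset.sum_congr rfl fun t ht => Set.indicator_of_mem ?_ _
    rw [Finset.mem_range] at ht
    exact fun r hr => hmin r (by omega)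
  · intro t ht
    rw [Finset.mem_range] at ht
    refine Set.indicator_of_notMem ?_ _
    exact fun h => Set.mem_ofPred.1 h s (by omega) hs

lemma sumUntil_eq_add {q : ℕ → Prop} (g : ℕ → ℝ≥0∞) {n : ℕ} (hmin : ∀ r < n, ¬ q r) :
    sumUntil q g = ∑ t ∈ Finset.range n, g t +
      sumUntil (fun t => q (n + t)) (fun t => g (n + t)) := by
  rw [sumUntil, ← ENNReal.summable.sum_add_tsum_nat_add' (k := n), sumUntil]
  congr 1
  · refine Finset.sum_congr rfl fun t ht => Set.indicator_of_mem ?_ _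
    rw [Finset.mem_range] at ht
    exact fun r hr => hmin r (by omega)
  · refine tsum_congr fun t => ?_
    rw [add_comm t n]
    by_cases h : ∀ r < t, ¬ q (n + r)
    · rw [Set.indicator_of_mem, Set.indicator_of_mem]
      · exact h
      · intro r hr
        by_cases hrn : r < n
        · exact hmin r hrn
        · have := h (r - n) (by omega)
          rwa [Nat.add_sub_of_le (by omega)] at this
    · rw [Set.indicator_of_notMem, Set.indicator_of_notMem]
      · exact h
      · exact fun h' => h fun r hr => Set.mem_ofPred.1 h' _ (by omega)

/-- Total cost of the slots up to the first successful access of user `i`. -/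
def successCost (f : SlotOutcome ι → ℝ≥0∞) (i : ι) (e : ℕ → SlotOutcome ι) : ℝ≥0∞ :=
  sumUntil (fun t => e t = .success i) fun t => f (e t)

/-- Total cost of the slots up to the first refresh moment of user `i`. -/
def refreshCost (f : SlotOutcome ι → ℝ≥0∞) (i : ι) (e : ℕ → SlotOutcome ι) : ℝ≥0∞ :=
  sumUntil (IsRefresh e i) fun t => f (e t)

/-- If another user succeeds next, the first success of `i` is its first refresh moment; otherwise
no refresh moment has occurred yet and the search restarts behind it. -/
lemma refreshCost_eq {f : SlotOutcome ι → ℝ≥0∞} {i : ι} {e : ℕ → SlotOutcome ι} {s : ℕ}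
    (hs : e s = .success i) (hmin : ∀ r < s, e r ≠ .success i) :
    refreshCost f i e = successCost f i e +
      {e | OtherFirst i e}ᶜ.indicator (refreshCost f i) (shift (s + 1) e) := by
  rw [successCost, sumUntil_eq_sum _ hs hmin]
  by_cases h : OtherFirst i (shift (s + 1) e)
  · rw [Set.indicator_of_notMem (by simpa using h), add_zero, refreshCost]
    exact sumUntil_eq_sum _ ((isRefresh_iff _ _ _).2 ⟨hs, h⟩) fun r hr hR => hmin r hr hR.1
  · rw [Set.indicator_of_mem (by simpa using h), refreshCost, sumUntil_eq_add (n := s + 1)]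
    · simp only [refreshCost, funext fun t => propext (isRefresh_shift e i (s + 1) t)]
      rfl
    · intro r hr hR
      rcases (Nat.lt_succ_iff.1 hr).lt_or_eq with hr | rfl
      · exact hmin r hr hR.1
      · exact h ((isRefresh_iff _ _ _).1 hR).2

lemma refreshCost_shift_refreshSlot {f : SlotOutcome ι → ℝ≥0∞} {i : ι} {e : ℕ → SlotOutcome ι}
    (h : {t | IsRefresh e i t}.Infinite) (k : ℕ) :
    ∃ n, refreshSlot e i (k + 1) = refreshSlot e i k + (n + 1) ∧
      refreshCost f i (shift (refreshSlot e i k + 1) e) =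
        ∑ t ∈ Finset.range (n + 1), f (e (refreshSlot e i k + 1 + t)) := by
  obtain ⟨h₁, h₂, h₃⟩ := Nat.nth_succ_spec h k
  change refreshSlot e i k < refreshSlot e i (k + 1) at h₂
  change ∀ r, refreshSlot e i k < r → r < refreshSlot e i (k + 1) → _ at h₃
  change IsRefresh e i (refreshSlot e i (k + 1)) at h₁
  obtain ⟨n, hn⟩ := Nat.exists_eq_add_of_lt h₂
  rw [add_right_comm] at hn
  refine ⟨n, by omega, sumUntil_eq_sum _ ?_ fun r hr => ?_⟩
  · rwa [isRefresh_shift, ← hn]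
  · rw [isRefresh_shift]
    exact h₃ _ (by omega) (by omega)

/-- If `q` never holds, `sumUntil` runs over all indices. Thus a finite mean of the unit cost yields
almost sure occurrence. -/
lemma exists_of_sumUntil_ne_top {q : ℕ → Prop} (h : sumUntil q (fun _ => 1) ≠ ∞) : ∃ t, q t := by
  by_contra! hq
  refine h ?_
  simp [sumUntil, hq]

end Channel

/-! ### Elapsed time as a sum of slot costs -/

namespace CSMA

variable (c : CSMA)

/-- Time taken by a slot and the inter-frame space that follows it. -/
def slotCost {ι : Type} (x : SlotOutcome ι) : ℝ := endTime.body c x + endTime.gap c x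

lemma slotCost_nonneg {ι : Type} (x : SlotOutcome ι) : 0 ≤ c.slotCost x := by
  have := c.Tslot_nonneg; have := c.difs_nonneg; have := c.pkt_nonneg; have := c.ack_nonneg
  have := c.rts_nonneg; have := c.cts_nonneg
  cases x <;> simp only [slotCost, endTime.body, endTime.gap, rcts, tran] <;> linarith

/-- Including the trailing inter-frame space at both ends makes the elapsed time a sum of terms that
depend on one slot each. -/
lemma endTime_add {ι : Type} (e : ℕ → SlotOutcome ι) (t n : ℕ) :
    c.endTime e (t + n) + endTime.gap c (e (t + n)) =
      c.endTime e t + endTime.gap c (e t) + ∑ s ∈ Finset.range n, c.slotCost (e (t + 1 + s)) := by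
  induction n with
  | zero => simp
  | succ n ih =>
    rw [Finset.sum_range_succ, ← add_assoc (c.endTime e t + _), ← ih, ← add_assoc t, endTime,
      slotCost, add_right_comm t 1 n]
    ring

end CSMA

end

noncomputable section

instance {ι : Type} : MeasurableSpace (SlotOutcome ι) := ⊤

instance {ι : Type} : DiscreteMeasurableSpace (SlotOutcome ι) := ⟨fun _ => trivial⟩

instance {ι : Type} [Finite ι] : Finite (SlotOutcome ι) := by
  refine Finite.of_injective (β := Option (Option ι))
    (fun | .idle => none | .success j => some (some j) | .collision => some none) ?_
  rintro (_ | _ | _) (_ | _ | _) h <;> simp_all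

namespace Channel

variable {ι : Type}

open scoped ENNReal

/-! ### Measurability on the space of traces -/

@[fun_prop]
lemma measurable_shift (n : ℕ) : Measurable (shift n : (ℕ → SlotOutcome ι) → _) :=
  measurable_pi_iff.2 fun t => measurable_pi_apply (n + t)

lemma measurable_success (i : ι) (t : ℕ) :
    Measurable fun e : ℕ → SlotOutcome ι => e t = .success i :=
  (Measurable.of_discrete (f := fun x : SlotOutcome ι => x = .success i)).comp
    (measurable_pi_apply t)

variable [Finite ι]

lemma measurable_otherFirst (i : ι) : Measurable (OtherFirst i) := by
  refine Measurable.exists fun s => .and (.exists fun j => .and measurable_const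
    (measurable_success j s)) (.forall fun r => .imp measurable_const (.forall fun j => ?_))
  exact (measurable_success j r).not

lemma measurableSet_otherFirst (i : ι) : MeasurableSet {e | OtherFirst i e} :=
  measurableSet_setOfPred.2 (measurable_otherFirst i)

lemma measurable_isRefresh (i : ι) (t : ℕ) :
    Measurable fun e : ℕ → SlotOutcome ι => IsRefresh e i t := by
  simp only [isRefresh_iff]
  exact (measurable_success i t).and ((measurable_otherFirst i).comp (measurable_shift _))

omit [Finite ι] in
lemma measurable_sumUntil {q : (ℕ → SlotOutcome ι) → ℕ → Prop} (hq : ∀ t, Measurable (q · t))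
    (f : SlotOutcome ι → ℝ≥0∞) : Measurable fun e => sumUntil (q e) fun t => f (e t) := by
  refine Measurable.tsum fun t => ?_
  have h : Measurable fun e : ℕ → SlotOutcome ι => f (e t) :=
    (Measurable.of_discrete (f := f)).comp (measurable_pi_apply t)
  exact h.indicator (s := {e | ∀ r < t, ¬ q e r}) (measurableSet_setOfPred.2
    (.forall fun r => .imp measurable_const (hq r).not))

omit [Finite ι] in
lemma measurable_successCost (f : SlotOutcome ι → ℝ≥0∞) (i : ι) : Measurable (successCost f i) :=
  measurable_sumUntil (measurable_success i) f

lemma measurable_refreshCost (f : SlotOutcome ι → ℝ≥0∞) (i : ι) : Measurable (refreshCost f i) :=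
  measurable_sumUntil (measurable_isRefresh i) f

/-- `Set.ncard` is `0` on infinite sets, so the count agrees with the measurable series only on
traces where `i` succeeds, which makes the set finite. -/
lemma exists_measurableSet_precedingOthers_eq (i : ι) (n : ℕ) :
    ∃ A, MeasurableSet A ∧ ∀ e : ℕ → SlotOutcome ι, (∃ t, e t = .success i) →
      (e ∈ A ↔ precedingOthers i e = n) := by
  let S (e : ℕ → SlotOutcome ι) : Set ℕ :=
    {s | (∀ r ≤ s, e r ≠ .success i) ∧ ∃ n, n ≠ i ∧ e s = .success n}
  refine ⟨{e | ∑' s, (S e).indicator (fun _ => (1 : ℝ≥0∞)) s = n}, ?_, ?_⟩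
  · refine (Measurable.tsum fun s => ?_) (measurableSet_singleton _)
    refine Measurable.indicator (s := {e | s ∈ S e}) measurable_const (measurableSet_setOfPred.2 ?_)
    exact .and (.forall fun r => .imp measurable_const (measurable_success i r).not)
      (.exists fun j => .and measurable_const (measurable_success j s))
  · rintro e ⟨t, ht⟩
    have hfin : (S e).Finite :=
      (Set.finite_Iio t).subset fun s hs => not_le.1 fun hts => hs.1 t hts ht
    rw [Set.mem_ofPred_eq, ← tsum_subtype, ENNReal.tsum_set_one, ← hfin.cast_ncard_eq]
    norm_cast

/-! ### Events that are determined by the past -/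

/-- The event `A` is determined by the outcomes of the slots `0, …, t`. -/
def IsPast (t : ℕ) (A : Set (ℕ → SlotOutcome ι)) : Prop :=
  ∀ e e', (∀ s ≤ t, e s = e' s) → e ∈ A → e' ∈ A

omit [Finite ι] in
lemma IsPast.eq_preimage {t : ℕ} {A : Set (ℕ → SlotOutcome ι)} (h : IsPast t A) :
    A = (Finset.range (t + 1)).restrict ⁻¹' ((Finset.range (t + 1)).restrict '' A) := by
  refine (Set.subset_preimage_image _ _).antisymm ?_
  rintro e ⟨e', he', hee⟩
  refine h e' e (fun s hs => ?_) he'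
  exact congrFun hee ⟨s, Finset.mem_range.2 (Nat.lt_succ_of_le hs)⟩

/-- A past event is a cylinder over finitely many possible prefixes. -/
lemma IsPast.measurableSet {t : ℕ} {A : Set (ℕ → SlotOutcome ι)} (h : IsPast t A) :
    MeasurableSet A := by
  rw [h.eq_preimage]
  exact Finset.measurable_restrict _ (Set.toFinite _).measurableSet

/-! ### Renewal at the successful accesses of a user -/

/-- After each successful access of user `i`, the channel starts afresh. -/
def IsRenewal (κ : Measure (ℕ → SlotOutcome ι)) (i : ι) : Prop :=
  ∀ t A, IsPast t A → (∀ e ∈ A, e t = .success i) → ∀ G : (ℕ → SlotOutcome ι) → ℝ≥0∞,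
    Measurable G → ∫⁻ e in A, G (shift (t + 1) e) ∂κ = κ A * ∫⁻ e, G e ∂κ

/-- Events `A t` that are determined by the slots `0, …, t` and that imply a successful access of
user `i` in slot `t`. -/
structure IsSuccessTime (i : ι) (A : ℕ → Set (ℕ → SlotOutcome ι)) : Prop where
  isPast : ∀ t, IsPast t (A t)
  success : ∀ t, ∀ e ∈ A t, e t = .success i

/-- The functional `G` of the trace after slot `t`, summed over all `t` for which `A t` occurs. -/
def after (A : ℕ → Set (ℕ → SlotOutcome ι)) (G : (ℕ → SlotOutcome ι) → ℝ≥0∞)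
    (e : ℕ → SlotOutcome ι) : ℝ≥0∞ :=
  ∑' t, (A t).indicator (fun e => G (shift (t + 1) e)) e

omit [Finite ι] in
lemma after_eq {A : ℕ → Set (ℕ → SlotOutcome ι)} {G : (ℕ → SlotOutcome ι) → ℝ≥0∞}
    {e : ℕ → SlotOutcome ι} {t : ℕ} (he : e ∈ A t)
    (h : ∀ s ≠ t, e ∈ A s → G (shift (s + 1) e) = 0) : after A G e = G (shift (t + 1) e) := by
  rw [after, tsum_eq_single t, Set.indicator_of_mem he]
  exact fun s hs => Set.indicator_apply_eq_zero.2 (h s hs)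

lemma IsSuccessTime.measurable_after {i : ι} {A : ℕ → Set (ℕ → SlotOutcome ι)}
    (hA : IsSuccessTime i A) {G : (ℕ → SlotOutcome ι) → ℝ≥0∞} (hG : Measurable G) :
    Measurable (after A G) :=
  .tsum fun t => (hG.comp (measurable_shift _)).indicator (hA.isPast t).measurableSet

lemma IsSuccessTime.lintegral_after {i : ι} {A : ℕ → Set (ℕ → SlotOutcome ι)}
    (hA : IsSuccessTime i A) {κ : Measure (ℕ → SlotOutcome ι)} (hκ : IsRenewal κ i)
    {G : (ℕ → SlotOutcome ι) → ℝ≥0∞} (hG : Measurable G) :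
    ∫⁻ e, after A G e ∂κ = (∑' t, κ (A t)) * ∫⁻ e, G e ∂κ := by
  have hm t := (hA.isPast t).measurableSet
  have hG' (t : ℕ) : AEMeasurable ((A t).indicator fun e => G (shift (t + 1) e)) κ :=
    ((hG.comp (measurable_shift _)).indicator (hm t)).aemeasurable
  simp only [after]
  rw [lintegral_tsum hG', ← ENNReal.tsum_mul_right]
  refine tsum_congr fun t => ?_
  rw [lintegral_indicator (hm t), hκ t _ (hA.isPast t) (hA.success t) G hG]

/-- The event that the first successful access of user `i` takes place in slot `t`. -/
def firstAt (i : ι) (t : ℕ) : Set (ℕ → SlotOutcome ι) :=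
  {e | e t = .success i ∧ ∀ r < t, e r ≠ .success i}

omit [Finite ι] in
lemma firstAt_unique {i : ι} {s t : ℕ} {e : ℕ → SlotOutcome ι} (hs : e ∈ firstAt i s)
    (ht : e ∈ firstAt i t) : s = t := by
  rcases lt_trichotomy s t with h | h | h
  · exact (ht.2 s h hs.1).elim
  · exact h
  · exact (hs.2 t h ht.1).elim

omit [Finite ι] in
lemma isSuccessTime_firstAt (i : ι) : IsSuccessTime i (firstAt i) where
  isPast t _ _ h he := ⟨h t le_rfl ▸ he.1, fun r hr => h r hr.le ▸ he.2 r hr⟩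
  success _ _ he := he.1

omit [Finite ι] in
-- User `i` succeeds in slot `t`, so the earliest success of any user has happened by then and
-- decides who came first.
lemma isSuccessTime_firstAt_inter (i : ι) :
    IsSuccessTime i fun t => firstAt i t ∩ {e | OtherFirst i e}ᶜ where
  isPast t e e' h he := by
    refine ⟨(isSuccessTime_firstAt i).isPast t e e' h he.1, ?_⟩
    rintro ⟨s, hs, hb⟩
    have hst : s ≤ t := not_lt.1 fun hts => hb t hts i (h t le_rfl ▸ he.1.1)
    exact he.2 ⟨s, h s hst ▸ hs, fun r hr j => h r (by omega) ▸ hb r hr j⟩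
  success t e he := he.1.1

omit [Finite ι] in
lemma exists_mem_firstAt {i : ι} {e : ℕ → SlotOutcome ι} (h : ∃ t, e t = .success i) :
    ∃ t, e ∈ firstAt i t :=
  Nat.exists_minimal_of_exists h

open Classical in
/-- The event that the `k`-th successful access of user `i` takes place in slot `t`. -/
def successAt (i : ι) (k t : ℕ) : Set (ℕ → SlotOutcome ι) :=
  {e | e t = .success i ∧ Nat.count (fun s => e s = .success i) t = k}

open Classical in
omit [Finite ι] in
lemma isSuccessTime_successAt (i : ι) (k : ℕ) : IsSuccessTime i (successAt i k) where
  isPast t e e' h he := by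
    refine ⟨h t le_rfl ▸ he.1, he.2 ▸ ?_⟩
    rw [Nat.count_eq_card_filter_range, Nat.count_eq_card_filter_range]
    congr 1
    refine Finset.filter_congr fun r hr => ?_
    rw [h r (Finset.mem_range.1 hr).le]
  success _ _ he := he.1

open Classical in
/-- The event that slot `t` is a successful access of user `i`, preceded by `k` refresh moments. -/
def refreshAt (i : ι) (k t : ℕ) : Set (ℕ → SlotOutcome ι) :=
  {e | e t = .success i ∧ Nat.count (IsRefresh e i) t = k}

open Classical in
omit [Finite ι] in
-- Whether slot `t` is itself a refresh moment depends on the future. This is why `refreshAt` counts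
-- only refresh moments before `t`, which the past determines once `t` is a success of `i`.
lemma isSuccessTime_refreshAt (i : ι) (k : ℕ) : IsSuccessTime i (refreshAt i k) where
  isPast t _ _ h he :=
    ⟨h t le_rfl ▸ he.1, (count_isRefresh_congr h he.1).symm.trans he.2⟩
  success _ _ he := he.1

section Renewal

variable {κ : Measure (ℕ → SlotOutcome ι)} {i : ι}

omit [Finite ι] in
lemma ae_exists_success (h : ∫⁻ e, successCost (fun _ => 1) i e ∂κ ≠ ∞) :
    ∀ᵐ e ∂κ, ∃ t, e t = .success i := by
  filter_upwards [ae_lt_top (measurable_successCost _ i) h] with e he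
  exact exists_of_sumUntil_ne_top he.ne

lemma IsRenewal.ae_shift (hκ : IsRenewal κ i) {Q : (ℕ → SlotOutcome ι) → Prop}
    (hQ : ∀ᵐ e ∂κ, Q e) : ∀ᵐ e ∂κ, ∀ t, e t = .success i → Q (shift (t + 1) e) := by
  refine ae_all_iff.2 fun t => ?_
  have hA : IsPast t {e : ℕ → SlotOutcome ι | e t = .success i} :=
    fun e e' h he => (h t le_rfl).symm.trans he
  -- `Q` need not be measurable, so the renewal identity is applied to a measurable hull of the null
  -- set where it fails.
  have h := hκ t _ hA (fun e he => he) ((toMeasurable κ {e | ¬ Q e}).indicator 1)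
    (measurable_one.indicator (measurableSet_toMeasurable _ _))
  rw [lintegral_indicator_one (measurableSet_toMeasurable _ _), measure_toMeasurable,
    ae_iff.1 hQ, mul_zero] at h
  have h' := (lintegral_eq_zero_iff ((measurable_one.indicator
    (measurableSet_toMeasurable _ _)).comp (measurable_shift _))).1 h
  filter_upwards [(ae_restrict_iff' hA.measurableSet).1 h'] with e he hs
  have := Set.indicator_apply_eq_zero.1 (he hs)
  by_contra hn
  exact one_ne_zero (this (subset_toMeasurable κ _ hn))

lemma IsRenewal.ae_infinite_success (hκ : IsRenewal κ i)
    (h : ∫⁻ e, successCost (fun _ => 1) i e ∂κ ≠ ∞) :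
    ∀ᵐ e ∂κ, {t | e t = .success i}.Infinite := by
  filter_upwards [ae_exists_success h, hκ.ae_shift (ae_exists_success h)] with e h₀ hs
  obtain ⟨t₀, h₀⟩ := h₀
  rw [← Nat.frequently_atTop_iff_infinite, Filter.frequently_atTop]
  intro n
  induction n with
  | zero => exact ⟨t₀, t₀.zero_le, h₀⟩
  | succ n ih =>
    obtain ⟨t, ht, hts⟩ := ih
    obtain ⟨t', ht'⟩ := hs t hts
    exact ⟨_, by omega, ht'⟩

omit [Finite ι] in
lemma after_successAt {e : ℕ → SlotOutcome ι} (h : {t | e t = .success i}.Infinite) (k : ℕ)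
    (G : (ℕ → SlotOutcome ι) → ℝ≥0∞) :
    after (successAt i k) G e = G (shift (successSlot e i k + 1) e) := by
  refine after_eq ((Nat.nth_eq_iff_count_eq h k _).1 rfl) fun s hs he => ?_
  exact absurd ((Nat.nth_eq_iff_count_eq h k s).2 he).symm hs

omit [Finite ι] in
-- The slots of `refreshAt i k` form a run of successes of `i` that ends with the `k`-th refresh
-- moment. Only the last is followed by another user's success, so the indicator leaves a single
-- term.
lemma after_refreshAt {e : ℕ → SlotOutcome ι} (h : {t | IsRefresh e i t}.Infinite) (k : ℕ)
    (G : (ℕ → SlotOutcome ι) → ℝ≥0∞) :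
    after (refreshAt i k) ({e | OtherFirst i e}.indicator G) e =
      G (shift (refreshSlot e i k + 1) e) := by
  obtain ⟨h₁, h₂⟩ := (Nat.nth_eq_iff_count_eq h k _).1 (Eq.refl (refreshSlot e i k))
  rw [isRefresh_iff] at h₁
  have hmem : e ∈ refreshAt i k (refreshSlot e i k) := ⟨h₁.1, h₂⟩
  rw [after_eq hmem, Set.indicator_of_mem]
  · exact h₁.2
  · refine fun s hs he => Set.indicator_of_notMem (fun hD => hs ?_) _
    exact ((Nat.nth_eq_iff_count_eq h k s).2 ⟨(isRefresh_iff _ _ _).2 ⟨he.1, hD⟩, he.2⟩).symm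

lemma IsRenewal.tsum_measure_successAt [IsProbabilityMeasure κ] (hκ : IsRenewal κ i)
    (h : ∫⁻ e, successCost (fun _ => 1) i e ∂κ ≠ ∞) (k : ℕ) :
    ∑' t, κ (successAt i k t) = 1 := by
  have := (isSuccessTime_successAt i k).lintegral_after hκ (G := fun _ => 1) measurable_const
  rw [lintegral_one, measure_univ, mul_one] at this
  rw [← this, lintegral_congr_ae (g := fun _ => 1), lintegral_one, measure_univ]
  filter_upwards [hκ.ae_infinite_success h] with e he
  rw [after_successAt he]

omit [Finite ι] in
lemma ae_eq_precedingOthers (h : ∀ᵐ e ∂κ, ∃ t, e t = .success i)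
    {A : Set (ℕ → SlotOutcome ι)} {n : ℕ} (hA : ∀ e : ℕ → SlotOutcome ι, (∃ t, e t = .success i) →
      (e ∈ A ↔ precedingOthers i e = n)) : {e | precedingOthers i e = n} =ᵐ[κ] A := by
  refine Filter.eventuallyEq_set.2 ?_
  filter_upwards [h] with e he using (hA e he).symm

lemma nullMeasurableSet_precedingOthers (h : ∀ᵐ e ∂κ, ∃ t, e t = .success i) (n : ℕ) :
    NullMeasurableSet {e | precedingOthers i e = n} κ := by
  obtain ⟨A, hA, hAn⟩ := exists_measurableSet_precedingOthers_eq i n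
  exact hA.nullMeasurableSet.congr (ae_eq_precedingOthers h hAn).symm

/-- The number of inter-transmissions has the same law after each successful access. -/
lemma IsRenewal.measure_interTrans [IsProbabilityMeasure κ] (hκ : IsRenewal κ i)
    (h : ∫⁻ e, successCost (fun _ => 1) i e ∂κ ≠ ∞) (j n : ℕ) :
    NullMeasurableSet {e | interTrans e i j = n} κ ∧
      κ {e | interTrans e i j = n} = κ {e | precedingOthers i e = n} := by
  obtain ⟨A, hA, hAn⟩ := exists_measurableSet_precedingOthers_eq i n
  have hsucc := ae_exists_success h
  have hG : Measurable (A.indicator (1 : (ℕ → SlotOutcome ι) → ℝ≥0∞)) := measurable_one.indicator hA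
  have hM : MeasurableSet {e | after (successAt i j) (A.indicator 1) e = 1} :=
    (isSuccessTime_successAt i j).measurable_after hG (measurableSet_singleton _)
  have key : ∀ᵐ e ∂κ, after (successAt i j) (A.indicator 1) e =
      {e | interTrans e i j = n}.indicator 1 e := by
    filter_upwards [hκ.ae_infinite_success h, hκ.ae_shift hsucc] with e he hs
    have hm : e (successSlot e i j) = .success i := Nat.nth_mem_of_infinite he j
    have hi := hAn _ (hs _ hm)
    rw [← interTrans_eq_precedingOthers he] at hi
    rw [after_successAt he]
    by_cases hn : interTrans e i j = n
    · simp [Set.indicator, hi.2 hn, hn]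
    · simp [Set.indicator, mt hi.1 hn, hn]
  have hae : {e | interTrans e i j = n} =ᵐ[κ]
      {e | after (successAt i j) (A.indicator 1) e = 1} := by
    refine Filter.eventuallyEq_set.2 ?_
    filter_upwards [key] with e he
    simp only [he]
    by_cases hn : interTrans e i j = n <;> simp [hn]
  have hint := (isSuccessTime_successAt i j).lintegral_after hκ hG
  rw [hκ.tsum_measure_successAt h, one_mul, lintegral_indicator_one hA, lintegral_congr_ae
    (g := {e | after (successAt i j) (A.indicator 1) e = 1}.indicator 1),
    lintegral_indicator_one hM] at hint
  · exact ⟨hM.nullMeasurableSet.congr hae.symm,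
      by rw [measure_congr (ae_eq_precedingOthers hsucc hAn), ← hint, measure_congr hae]⟩
  · filter_upwards [key] with e he
    by_cases hn : interTrans e i j = n <;> simp [Set.indicator, he, hn]

/-! ### Mean cost of a cycle by renewal -/

section Cost

variable {f : SlotOutcome ι → ℝ≥0∞}

lemma tsum_measure_firstAt_inter [IsProbabilityMeasure κ]
    (h : ∫⁻ e, successCost (fun _ => 1) i e ∂κ ≠ ∞) {B : Set (ℕ → SlotOutcome ι)}
    (hB : MeasurableSet B) : ∑' t, κ (firstAt i t ∩ B) = κ B := by
  rw [← measure_iUnion]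
  · refine measure_congr (Filter.eventuallyEq_set.2 ?_)
    filter_upwards [ae_exists_success h] with e he
    simp only [Set.mem_iUnion, Set.mem_inter_iff, exists_and_right, and_iff_right_iff_imp]
    exact fun _ => exists_mem_firstAt he
  · exact fun s t hst => Set.disjoint_left.2 fun e hs ht => hst (firstAt_unique hs.1 ht.1)
  · exact fun t => ((isSuccessTime_firstAt i).isPast t).measurableSet.inter hB

/-- Until the first refresh moment, only finite costs accumulate on average. -/
lemma IsRenewal.setLIntegral_refreshCost_ne_top [IsProbabilityMeasure κ] (hκ : IsRenewal κ i)
    (h : ∫⁻ e, successCost (fun _ => 1) i e ∂κ ≠ ∞) (hD : κ {e | OtherFirst i e} ≠ 0)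
    (hf : ∫⁻ e, successCost f i e ∂κ ≠ ∞) :
    ∫⁻ e in {e | OtherFirst i e}ᶜ, refreshCost f i e ∂κ ≠ ∞ := by
  have hDm := measurableSet_otherFirst i
  set D := {e : ℕ → SlotOutcome ι | OtherFirst i e}
  have hD1 : κ Dᶜ < 1 := by
    rw [prob_compl_eq_one_sub hDm]
    exact ENNReal.sub_lt_self ENNReal.one_ne_top one_ne_zero hD
  -- The estimate below has the estimated quantity also on its right, with factor `κ Dᶜ < 1`.
  -- Truncation at `n` makes it finite, so that it can be absorbed before `n` tends to infinity.
  let Y (n : ℕ) (e : ℕ → SlotOutcome ι) : ℝ≥0∞ := refreshCost f i e ⊓ n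
  have hY n : Measurable (Y n) := (measurable_refreshCost f i).min measurable_const
  -- `Dᶜ` is settled at the first success of `i`, hence independent of what follows; this produces
  -- the factor `κ Dᶜ`.
  have hbound n : ∫⁻ e in Dᶜ, Y n e ∂κ ≤
      ∫⁻ e, successCost f i e ∂κ + κ Dᶜ * ∫⁻ e in Dᶜ, Y n e ∂κ := by
    have hG := (hY n).indicator hDm.compl
    have := (isSuccessTime_firstAt_inter i).lintegral_after hκ hG
    rw [tsum_measure_firstAt_inter h hDm.compl, lintegral_indicator hDm.compl] at this
    rw [← this, ← lintegral_indicator hDm.compl, ← lintegral_add_left (measurable_successCost f i)]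
    refine lintegral_mono_ae ?_
    filter_upwards [ae_exists_success h] with e he
    refine Set.indicator_apply_le' (fun heD => ?_) fun _ => zero_le
    obtain ⟨t, ht⟩ := exists_mem_firstAt he
    have hmem : e ∈ firstAt i t ∩ Dᶜ := ⟨ht, heD⟩
    rw [after_eq (A := fun t => firstAt i t ∩ Dᶜ) hmem
      fun s hs hes => absurd (firstAt_unique hes.1 ht) hs]
    change refreshCost f i e ⊓ n ≤ _
    rw [refreshCost_eq ht.1 ht.2]
    by_cases hs : shift (t + 1) e ∈ D
    · rw [Set.indicator_of_notMem (Set.notMem_compl_iff.2 hs),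
        Set.indicator_of_notMem (Set.notMem_compl_iff.2 hs)]
      exact inf_le_left
    · rw [Set.indicator_of_mem (show _ ∈ Dᶜ from hs), Set.indicator_of_mem (show _ ∈ Dᶜ from hs)]
      change _ ≤ successCost f i e + refreshCost f i (shift (t + 1) e) ⊓ (n : ℝ≥0∞)
      rcases le_total (refreshCost f i (shift (t + 1) e)) n with hn | hn
      · rw [inf_eq_left.2 hn]
        exact inf_le_left
      · rw [inf_eq_right.2 hn]
        exact inf_le_right.trans le_add_self
  have hle n : ∫⁻ e in Dᶜ, Y n e ∂κ ≤ (∫⁻ e, successCost f i e ∂κ) / (1 - κ Dᶜ) := by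
    have hfin : ∫⁻ e in Dᶜ, Y n e ∂κ ≠ ∞ := by
      refine ne_top_of_le_ne_top ?_ (lintegral_mono (g := fun _ => (n : ℝ≥0∞)) fun e => inf_le_right)
      rw [lintegral_const]
      exact ENNReal.mul_ne_top (ENNReal.natCast_ne_top n) (measure_ne_top _ _)
    rw [ENNReal.le_div_iff_mul_le (.inl (tsub_pos_of_lt hD1).ne') (.inl (by simp)), mul_comm,
      ENNReal.sub_mul fun _ _ => hfin, one_mul]
    exact tsub_le_iff_right.2 (hbound n)
  have hsup : ∫⁻ e in Dᶜ, refreshCost f i e ∂κ = ⨆ n, ∫⁻ e in Dᶜ, Y n e ∂κ := by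
    rw [← lintegral_iSup hY fun m n hmn e => inf_le_inf_left _ (by exact_mod_cast hmn)]
    refine lintegral_congr fun e => ?_
    simp only [Y, ← inf_iSup_eq, ENNReal.iSup_natCast, inf_top_eq]
  rw [hsup]
  exact ne_top_of_le_ne_top (ENNReal.div_ne_top hf (tsub_pos_of_lt hD1).ne') (iSup_le hle)

/-- The part of the mean refresh cost that comes from traces on which another user is the first to
succeed equals the mean cost until the first success. -/
lemma IsRenewal.setLIntegral_refreshCost [IsProbabilityMeasure κ] (hκ : IsRenewal κ i)
    (h : ∫⁻ e, successCost (fun _ => 1) i e ∂κ ≠ ∞) (hD : κ {e | OtherFirst i e} ≠ 0)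
    (hf : ∫⁻ e, successCost f i e ∂κ ≠ ∞) :
    ∫⁻ e in {e | OtherFirst i e}, refreshCost f i e ∂κ = ∫⁻ e, successCost f i e ∂κ := by
  have hDm := measurableSet_otherFirst i
  have hG := (measurable_refreshCost f i).indicator hDm.compl
  have hY : ∫⁻ e, refreshCost f i e ∂κ =
      ∫⁻ e, successCost f i e ∂κ + ∫⁻ e in {e | OtherFirst i e}ᶜ, refreshCost f i e ∂κ := by
    have := (isSuccessTime_firstAt i).lintegral_after hκ hG
    have h1 := tsum_measure_firstAt_inter h MeasurableSet.univ
    simp only [Set.inter_univ, measure_univ] at h1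
    rw [h1, one_mul, lintegral_indicator hDm.compl] at this
    rw [← this, ← lintegral_add_left (measurable_successCost f i)]
    refine lintegral_congr_ae ?_
    filter_upwards [ae_exists_success h] with e he
    obtain ⟨t, ht⟩ := exists_mem_firstAt he
    rw [after_eq ht fun s hs hes => absurd (firstAt_unique hes ht) hs,
      refreshCost_eq ht.1 ht.2]
  rw [← lintegral_add_compl _ hDm] at hY
  -- The contribution of `Dᶜ` occurs on both sides and cancels because it is finite.
  exact (ENNReal.add_left_inj (hκ.setLIntegral_refreshCost_ne_top h hD hf)).1 hY

lemma IsRenewal.ae_infinite_refresh [IsProbabilityMeasure κ] (hκ : IsRenewal κ i)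
    (h : ∫⁻ e, successCost (fun _ => 1) i e ∂κ ≠ ∞) (hD : κ {e | OtherFirst i e} ≠ 0) :
    ∀ᵐ e ∂κ, {t | IsRefresh e i t}.Infinite := by
  have hR : ∀ᵐ e ∂κ, ∃ t, IsRefresh e i t := by
    have hfin : ∫⁻ e, refreshCost (fun _ => 1) i e ∂κ ≠ ∞ := by
      rw [← lintegral_add_compl _ (measurableSet_otherFirst i),
        hκ.setLIntegral_refreshCost h hD h]
      exact ENNReal.add_ne_top.2 ⟨h, hκ.setLIntegral_refreshCost_ne_top h hD h⟩
    filter_upwards [ae_lt_top (measurable_refreshCost _ i) hfin] with e he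
    exact exists_of_sumUntil_ne_top he.ne
  filter_upwards [hκ.ae_infinite_success h, hκ.ae_shift hR] with e he hs
  rw [← Nat.frequently_atTop_iff_infinite, Filter.frequently_atTop] at he ⊢
  intro n
  obtain ⟨t, ht, hts⟩ := he n
  obtain ⟨t', ht'⟩ := hs t hts
  exact ⟨_, by omega, (isRefresh_shift _ _ _ _).1 ht'⟩

/-- Almost surely exactly one slot of `refreshAt i k` is followed by another user's success, and
each is so with probability `κ D` given its past, where `D` is the event `OtherFirst`. -/
lemma IsRenewal.tsum_measure_refreshAt_mul [IsProbabilityMeasure κ] (hκ : IsRenewal κ i)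
    (h : ∫⁻ e, successCost (fun _ => 1) i e ∂κ ≠ ∞) (hD : κ {e | OtherFirst i e} ≠ 0) (k : ℕ) :
    (∑' t, κ (refreshAt i k t)) * κ {e | OtherFirst i e} = 1 := by
  have hDm := measurableSet_otherFirst i
  have hG : Measurable ({e | OtherFirst i e}.indicator (1 : (ℕ → SlotOutcome ι) → ℝ≥0∞)) :=
    measurable_one.indicator hDm
  have := (isSuccessTime_refreshAt i k).lintegral_after hκ hG
  rw [lintegral_indicator_one hDm] at this
  rw [← this, lintegral_congr_ae (g := fun _ => 1), lintegral_one, measure_univ]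
  filter_upwards [hκ.ae_infinite_refresh h hD] with e he
  rw [after_refreshAt he, Pi.one_apply]

/-- The mean cost of a cycle is the mean cost until a success, divided by the probability that
another user succeeds first. -/
lemma IsRenewal.lintegral_after_refreshAt [IsProbabilityMeasure κ] (hκ : IsRenewal κ i)
    (h : ∫⁻ e, successCost (fun _ => 1) i e ∂κ ≠ ∞) (hD : κ {e | OtherFirst i e} ≠ 0)
    (hf : ∫⁻ e, successCost f i e ∂κ ≠ ∞) (k : ℕ) :
    ∫⁻ e, after (refreshAt i k) ({e | OtherFirst i e}.indicator (refreshCost f i)) e ∂κ =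
      (∫⁻ e, successCost f i e ∂κ) / κ {e | OtherFirst i e} := by
  have hDm := measurableSet_otherFirst i
  rw [(isSuccessTime_refreshAt i k).lintegral_after hκ ((measurable_refreshCost f i).indicator hDm),
    lintegral_indicator hDm, hκ.setLIntegral_refreshCost h hD hf, mul_comm, div_eq_mul_inv,
    ENNReal.eq_inv_of_mul_eq_one_left (hκ.tsum_measure_refreshAt_mul h hD k)]

end Cost

end Renewal

end Channel

end

noncomputable section

lemma ProbabilityTheory.IndepFun.iIndepFun_bool {Ω α : Type*} {_ : MeasurableSpace Ω}
    {_ : MeasurableSpace α} {μ : Measure Ω} [IsProbabilityMeasure μ] {X : Bool → Ω → α}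
    (h : X true ⟂ᵢ[μ] X false) : iIndepFun X μ := by
  rw [iIndepFun_iff_measure_inter_preimage_eq_mul]
  intro S sets hS
  have := h.measure_inter_preimage_eq_mul (sets true) (sets false)
  have hcases : S = ∅ ∨ S = {true} ∨ S = {false} ∨ S = {true, false} := by
    clear hS; revert S; decide
  have hI : ⋂ i, X i ⁻¹' sets i = X true ⁻¹' sets true ∩ X false ⁻¹' sets false := by
    ext; simp [and_comm]
  rcases hcases with rfl | rfl | rfl | rfl <;> simp_all

namespace CSMA

variable (c : CSMA)

open scoped ENNReal

/-! ### The noise of one slot -/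

lemma lintegral_noiseLaw (p : unitInterval) (j : Fin (c.β + 1)) (F : Bool → ℕ → ℝ≥0∞) :
    ∫⁻ ξ, F ξ.1 (ξ.2 j) ∂(c.noiseLaw p) =
      ENNReal.ofReal p * ∫⁻ n, F true n ∂(uniformOn (Set.Icc 1 (c.cw j))) +
        ENNReal.ofReal (1 - p) * ∫⁻ n, F false n ∂(uniformOn (Set.Icc 1 (c.cw j))) := by
  rw [noiseLaw, lintegral_prod _ Measurable.of_discrete.aemeasurable]
  have h (b : Bool) : ∫⁻ d, F b (d j) ∂(Measure.pi fun i : Fin (c.β + 1) =>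
      uniformOn (Set.Icc 1 (c.cw i))) = ∫⁻ n, F b n ∂(uniformOn (Set.Icc 1 (c.cw j))) :=
    (measurePreserving_eval (fun i : Fin (c.β + 1) => uniformOn (Set.Icc 1 (c.cw i))) j).lintegral_comp
      Measurable.of_discrete
  simp only [h, bernoulliMeasure_def]
  rw [lintegral_add_measure, lintegral_smul_measure, lintegral_smul_measure,
    lintegral_dirac, lintegral_dirac]
  simp only [ENNReal.smul_def, smul_eq_mul, ENNReal.ofReal]
  congr 3
  · simp only [unitInterval.toNNReal, Real.toNNReal, p.2.1, sup_of_le_left]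
    rfl
  · simp only [unitInterval.toNNReal, Real.toNNReal, sub_nonneg.2 p.2.2, sup_of_le_left]
    rfl

lemma lintegral_uniformOn_Icc (N : ℕ) (F : ℕ → ℝ≥0∞) :
    ∫⁻ n, F n ∂(uniformOn (Set.Icc 1 N)) = (N : ℝ≥0∞)⁻¹ * ∑ n ∈ Finset.Icc 1 N, F n := by
  rw [uniformOn, ProbabilityTheory.cond, lintegral_smul_measure, ← Finset.coe_Icc, lintegral_finset,
    Measure.count_apply_finset]
  simp

/-- The mean of a counter drawn after `i` collisions. -/
def meanCounter (i : ℕ) : ℝ := (c.cw i + 1) / 2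

lemma lintegral_counter (i : ℕ) {a b : ℝ} (ha : 0 ≤ a) (hb : 0 ≤ b) :
    ∫⁻ n : ℕ, ENNReal.ofReal (n * a + b) ∂(uniformOn (Set.Icc 1 (c.cw i))) =
      ENNReal.ofReal (c.meanCounter i * a + b) := by
  have hN : (0 : ℝ) < c.cw i := by exact_mod_cast c.cw_pos i
  rw [lintegral_uniformOn_Icc, ← ENNReal.ofReal_sum_of_nonneg fun n _ => by positivity,
    ← ENNReal.ofReal_natCast, ← ENNReal.ofReal_inv_of_pos hN, ← ENNReal.ofReal_mul (by positivity)]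
  congr 1
  have hs (N : ℕ) : ∑ n ∈ Finset.Icc 1 N, ((n : ℝ) * a + b) = N * ((N + 1) / 2 * a + b) := by
    induction N with
    | zero => simp
    | succ N ih => rw [Finset.sum_Icc_succ_top (by omega), ih]; push_cast; ring
  rw [hs, meanCounter]
  field_simp

/-! ### Independence of the noise -/

/-- For each slot, the transmission bit and the draws as two random variables with values in the
same space. -/
def piece (q : ℕ × Bool) (ω : ℕ → c.Noise) : c.Noise :=
  if q.2 then ((ω q.1).1, 0) else (false, (ω q.1).2)

lemma measurable_piece (q : ℕ × Bool) : Measurable (c.piece q) :=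
  (Measurable.of_discrete (f := fun x : c.Noise => if q.2 then (x.1, 0) else (false, x.2))).comp
    (measurable_pi_apply q.1)

/-- Entry `t + 1` holds both the bit of slot `t` and the counters drawn at its end. These lie on
different sides of a renewal, hence the splitting of each entry. -/
lemma iIndepFun_piece (p : unitInterval) : iIndepFun c.piece (c.law p) := by
  refine iIndepFun_uncurry' (X := fun t b => c.piece (t, b)) (fun t b => c.measurable_piece _) ?_ ?_
  · exact iIndepFun_infinitePi (P := fun _ => c.noiseLaw p)
      (X := fun _ (x : c.Noise) (b : Bool) => if b then (x.1, (0 : Fin (c.β + 1) → ℕ)) else (false, x.2))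
      fun _ => .of_discrete
  · intro t
    refine IndepFun.iIndepFun_bool ?_
    have h : (fun x : c.Noise => (x.1, (0 : Fin (c.β + 1) → ℕ))) ⟂ᵢ[c.noiseLaw p]
        fun x => (false, x.2) :=
      indepFun_prod (X := fun b : Bool => (b, (0 : Fin (c.β + 1) → ℕ)))
        (Y := fun d : Fin (c.β + 1) → ℕ => (false, d)) .of_discrete .of_discrete
    have hm := measurePreserving_eval_infinitePi (fun _ => c.noiseLaw p) t
    rw [indepFun_iff_measure_inter_preimage_eq_mul] at h ⊢
    intro A B hA hB
    have := h A B hA hB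
    rw [← hm.measure_preimage MeasurableSet.of_discrete.nullMeasurableSet,
      ← hm.measure_preimage MeasurableSet.of_discrete.nullMeasurableSet,
      ← hm.measure_preimage MeasurableSet.of_discrete.nullMeasurableSet] at this
    exact this

/-- The information contained in the given pieces of the noise. -/
@[reducible]
def info (I : Set (ℕ × Bool)) : MeasurableSpace (ℕ → c.Noise) :=
  ⨆ q ∈ I, MeasurableSpace.comap (c.piece q) inferInstance

lemma info_le (I : Set (ℕ × Bool)) : c.info I ≤ MeasurableSpace.pi :=
  iSup₂_le fun q _ => (c.measurable_piece q).comap_le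

lemma indep_info (p : unitInterval) {I J : Set (ℕ × Bool)} (h : Disjoint I J) :
    Indep (c.info I) (c.info J) (c.law p) :=
  indep_iSup_of_disjoint (fun q => (c.measurable_piece q).comap_le) (c.iIndepFun_piece p) h

lemma measurable_piece_info {I : Set (ℕ × Bool)} {q : ℕ × Bool} (h : q ∈ I) :
    Measurable[c.info I] (c.piece q) :=
  Measurable.of_comap_le (le_iSup₂_of_le q h le_rfl)

lemma measurable_fst_info {I : Set (ℕ × Bool)} {t : ℕ} (h : (t, true) ∈ I) :
    Measurable[c.info I] fun ω : ℕ → c.Noise => (ω t).1 := by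
  have := (Measurable.of_discrete (f := fun x : c.Noise => x.1)).comp (c.measurable_piece_info h)
  exact this

lemma measurable_snd_info {I : Set (ℕ × Bool)} {t : ℕ} (h : (t, false) ∈ I) :
    Measurable[c.info I] fun ω : ℕ → c.Noise => (ω t).2 := by
  have := (Measurable.of_discrete (f := fun x : c.Noise => x.2)).comp (c.measurable_piece_info h)
  exact this

lemma measurable_eval_info {I : Set (ℕ × Bool)} {t : ℕ} (h : ∀ b, (t, b) ∈ I) :
    Measurable[c.info I] fun ω : ℕ → c.Noise => ω t :=
  (c.measurable_fst_info (h true)).prodMk (c.measurable_snd_info (h false))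

/-! ### Measurability and regeneration of the channel trace -/

lemma measurable_state {Ω : Type*} {mΩ : MeasurableSpace Ω} {θ : Ω → ℕ → c.Noise} {t : ℕ}
    (h₀ : Measurable fun ω => (θ ω 0).2) (h : ∀ s < t, Measurable fun ω => θ ω (s + 1)) :
    Measurable fun ω => c.state (θ ω) t := by
  induction t with
  | zero => exact (Measurable.of_discrete (f := fun d : Fin (c.β + 1) → ℕ => ((0, d 0) : c.State))).comp h₀
  | succ t ih =>
    exact (Measurable.of_discrete (f := fun z : c.State × c.Noise => c.step z.1 z.2)).comp
      ((ih fun s hs => h s (by omega)).prodMk (h t (by omega)))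

/-- The outcome of a slot for user `u` in state `x`, if `b` tells whether the other user
transmits. -/
def outcome (u : Fin 2) (x : c.State) (b : Bool) : SlotOutcome (Fin 2) :=
  if x.2 = 0 then if b then .collision else .success u
  else if b then .success (1 - u) else .idle

lemma trace_eq_outcome (u : Fin 2) (ω : ℕ → c.Noise) (t : ℕ) :
    c.trace u ω t = c.outcome u (c.state ω t) (ω (t + 1)).1 := rfl

lemma measurable_trace_apply (u : Fin 2) {Ω : Type*} {mΩ : MeasurableSpace Ω} {θ : Ω → ℕ → c.Noise}
    {t : ℕ} (h₀ : Measurable fun ω => (θ ω 0).2) (h : ∀ s < t, Measurable fun ω => θ ω (s + 1))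
    (ht : Measurable fun ω => (θ ω (t + 1)).1) : Measurable fun ω => c.trace u (θ ω) t :=
  (Measurable.of_discrete (f := fun z : c.State × Bool => c.outcome u z.1 z.2)).comp
    ((c.measurable_state h₀ h).prodMk ht)

lemma measurable_trace (u : Fin 2) : Measurable (c.trace u) :=
  measurable_pi_iff.2 fun t => c.measurable_trace_apply u
    (measurable_snd.comp (measurable_pi_apply 0)) (fun s _ => measurable_pi_apply (s + 1))
    (measurable_fst.comp (measurable_pi_apply (t + 1)))

lemma trace_eq_success_self_iff {u : Fin 2} {ω : ℕ → c.Noise} {t : ℕ} :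
    c.trace u ω t = .success u ↔ (c.state ω t).2 = 0 ∧ (ω (t + 1)).1 = false := by
  have : 1 - u ≠ u := by omega
  unfold trace
  split_ifs <;> simp_all

lemma trace_eq_success_other_iff {u : Fin 2} {ω : ℕ → c.Noise} {t : ℕ} :
    (∃ n, n ≠ u ∧ c.trace u ω t = .success n) ↔ (c.state ω t).2 ≠ 0 ∧ (ω (t + 1)).1 = true := by
  have : 1 - u ≠ u := by omega
  unfold trace
  split_ifs <;> simp_all

/-- The noise from slot `t` on; its first entry is used to draw the counter in slot `t`. -/
def shiftNoise (t : ℕ) (ω : ℕ → c.Noise) : ℕ → c.Noise := fun s => ω (t + s)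

lemma map_shiftNoise (p : unitInterval) (t : ℕ) :
    (c.law p).map (c.shiftNoise t) = c.law p :=
  Measure.map_infinitePi_infinitePi_of_inj (P := fun _ => c.noiseLaw p) (add_right_injective t)

lemma measurable_shiftNoise (t : ℕ) : Measurable (c.shiftNoise t) :=
  measurable_pi_iff.2 fun s => measurable_pi_apply (t + s)

/-- A success resets the stage to `0` and draws from entry `t + 1`, just as the initial state draws
from entry `0` of the shifted noise. -/
lemma state_shiftNoise {u : Fin 2} {ω : ℕ → c.Noise} {t : ℕ} (h : c.trace u ω t = .success u)
    (s : ℕ) : c.state (c.shiftNoise (t + 1) ω) s = c.state ω (t + 1 + s) := by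
  induction s with
  | zero =>
    obtain ⟨h₁, h₂⟩ := c.trace_eq_success_self_iff.1 h
    simp [state, step, h₁, h₂, shiftNoise]
  | succ s ih => rw [state, ih, ← add_assoc, state]; rfl

lemma trace_shiftNoise {u : Fin 2} {ω : ℕ → c.Noise} {t : ℕ} (h : c.trace u ω t = .success u) :
    c.trace u (c.shiftNoise (t + 1) ω) = Channel.shift (t + 1) (c.trace u ω) := by
  funext s
  simp only [Channel.shift, trace_eq_outcome, c.state_shiftNoise h]
  rfl

/-- The law of the channel trace as seen by user `u`. -/
def traceLaw (u : Fin 2) (p : unitInterval) : Measure (ℕ → SlotOutcome (Fin 2)) :=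
  (c.law p).map (c.trace u)

instance (u : Fin 2) (p : unitInterval) : IsProbabilityMeasure (c.traceLaw u p) :=
  Measure.isProbabilityMeasure_map (c.measurable_trace u).aemeasurable

lemma isRenewal_traceLaw (u : Fin 2) (p : unitInterval) :
    Channel.IsRenewal (c.traceLaw u p) u := by
  intro t A hA hsucc G hG
  have hm := c.measurable_trace u
  -- The past consists of the entries up to `t` and the bit of entry `t + 1`, which decides slot
  -- `t`; the draws of entry `t + 1` already belong to the future.
  let I : Set (ℕ × Bool) := {q | q.1 ≤ t ∨ q = (t + 1, true)}
  have hAI : MeasurableSet[c.info I] (c.trace u ⁻¹' A) := by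
    have : Measurable[c.info I] fun ω => (Finset.range (t + 1)).restrict (c.trace u ω) := by
      refine @measurable_pi_lambda _ _ _ (c.info I) _ _ fun s => ?_
      have hs : (s : ℕ) < t + 1 := Finset.mem_range.1 s.2
      refine @measurable_trace_apply c u _ (c.info I) _ _ (c.measurable_snd_info (.inl t.zero_le))
        (fun r hr => c.measurable_eval_info fun b => .inl (by simp; omega))
        (c.measurable_fst_info ?_)
      rcases (Nat.lt_succ_iff.1 hs).lt_or_eq with h | h
      · exact .inl h
      · exact .inr (by rw [h])
    rw [hA.eq_preimage]
    exact this (Set.toFinite _).measurableSet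
  have hGI : Measurable[c.info Iᶜ] fun ω => G (c.trace u (c.shiftNoise (t + 1) ω)) := by
    refine hG.comp (@measurable_pi_lambda _ _ _ (c.info Iᶜ) _ _ fun s => ?_)
    refine @measurable_trace_apply c u _ (c.info Iᶜ) _ _ (c.measurable_snd_info ?_)
      (fun r hr => c.measurable_eval_info fun b => ?_) (c.measurable_fst_info ?_) <;> simp [I] <;> omega
  have hind : Measurable[c.info I] ((c.trace u ⁻¹' A).indicator (1 : (ℕ → c.Noise) → ℝ≥0∞)) :=
    @Measurable.indicator _ _ _ 1 (c.info I) _ _ (@measurable_const _ _ _ (c.info I) 1) hAI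
  have hprod := lintegral_mul_eq_lintegral_mul_lintegral_of_independent_measurableSpace
    (c.info_le I) (c.info_le Iᶜ) (c.indep_info p disjoint_compl_right) hind hGI
  have hmG : Measurable fun ω => G (c.trace u ω) := hG.comp hm
  have hGs : Measurable fun e => G (Channel.shift (t + 1) e) :=
    hG.comp (Channel.measurable_shift _)
  rw [traceLaw, setLIntegral_map hA.measurableSet hGs hm,
    Measure.map_apply hm hA.measurableSet, lintegral_map hG hm]
  rw [lintegral_indicator_one (hm hA.measurableSet), ← lintegral_map hmG
    (c.measurable_shiftNoise (t + 1)), map_shiftNoise] at hprod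
  rw [← hprod, ← lintegral_indicator (hm hA.measurableSet)]
  refine lintegral_congr fun ω => ?_
  by_cases hω : ω ∈ c.trace u ⁻¹' A
  · rw [Set.indicator_of_mem hω, Set.indicator_of_mem hω, c.trace_shiftNoise (hsucc _ hω),
      Pi.one_apply, one_mul]
  · rw [Set.indicator_of_notMem hω, Set.indicator_of_notMem hω, zero_mul]

end CSMA

end

noncomputable section

namespace CSMA

variable (c : CSMA)

open scoped ENNReal

/-! ### Mean cost until the first success -/

/-- Whatever is read off from entries up to `t` is independent of entry `t + 1`, which can therefore
be integrated out with the past frozen. -/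
lemma lintegral_past_noise (p : unitInterval) (t : ℕ) {α : Type*} [MeasurableSpace α]
    [DiscreteMeasurableSpace α] [Countable α] {Z : (ℕ → c.Noise) → α}
    (hZ : Measurable[c.info {q | q.1 ≤ t}] Z) (F : α → c.Noise → ℝ≥0∞) :
    ∫⁻ ω, F (Z ω) (ω (t + 1)) ∂(c.law p) = ∫⁻ ω, ∫⁻ ξ, F (Z ω) ξ ∂(c.noiseLaw p) ∂(c.law p) := by
  have hZm : Measurable Z := hZ.mono (c.info_le _) le_rfl
  have hξ : Measurable fun ω : ℕ → c.Noise => ω (t + 1) := measurable_pi_apply _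
  have hind : Z ⟂ᵢ[c.law p] fun ω => ω (t + 1) := by
    have h := c.indep_info p (disjoint_compl_right (a := {q : ℕ × Bool | q.1 ≤ t}))
    have hξ' : Measurable[c.info {q : ℕ × Bool | q.1 ≤ t}ᶜ] fun ω : ℕ → c.Noise => ω (t + 1) :=
      c.measurable_eval_info fun b => by simp
    exact indep_of_indep_of_le h hZ.comap_le hξ'.comap_le
  have hmap := (indepFun_iff_map_prod_eq_prod_map_map hZm.aemeasurable hξ.aemeasurable).1 hind
  have heval : (c.law p).map (fun ω => ω (t + 1)) = c.noiseLaw p :=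
    (measurePreserving_eval_infinitePi (fun _ => c.noiseLaw p) (t + 1)).map_eq
  have hF : Measurable fun z : α × c.Noise => F z.1 z.2 := .of_discrete
  have h1 := lintegral_map (μ := c.law p) hF (hZm.prodMk hξ)
  rw [hmap, heval, lintegral_prod _ hF.aemeasurable, lintegral_map .of_discrete hZm] at h1
  exact h1.symm

/-- No successful access of user `u` has taken place before slot `t`. -/
def Alive (u : Fin 2) (t : ℕ) (ω : ℕ → c.Noise) : Prop := ∀ r < t, c.trace u ω r ≠ .success u

lemma alive_succ {u : Fin 2} {t : ℕ} {ω : ℕ → c.Noise} :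
    c.Alive u (t + 1) ω ↔ c.Alive u t ω ∧ c.trace u ω t ≠ .success u := by
  simp only [Alive, Nat.lt_succ_iff_lt_or_eq, or_imp, forall_and, forall_eq]

lemma measurable_alive_info (u : Fin 2) (t : ℕ) :
    Measurable[c.info {q | q.1 ≤ t}] (c.Alive u t) := by
  refine @Measurable.forall _ _ (c.info _) _ _ fun r => ?_
  by_cases hr : r < t
  · have : Measurable[c.info {q : ℕ × Bool | q.1 ≤ t}] fun ω => c.trace u ω r :=
      @measurable_trace_apply c u _ (c.info _) _ _ (c.measurable_snd_info (by simp))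
        (fun s hs => c.measurable_eval_info fun b => by simp; omega)
        (c.measurable_fst_info (by simp; omega))
    have h := (Measurable.of_discrete (f := fun x => r < t → x ≠ SlotOutcome.success u)).comp this
    exact h
  · simp only [hr, false_imp_iff]
    exact @measurable_const _ _ _ (c.info _) _

lemma measurable_state_info (t : ℕ) :
    Measurable[c.info {q | q.1 ≤ t}] fun ω => c.state ω t :=
  @measurable_state c _ (c.info _) _ _ (c.measurable_snd_info (by simp))
    fun s hs => c.measurable_eval_info fun b => by simp; omega

/-- `v` is the mean cost until the next success of user `u` as a function of the state. -/
def IsValue (u : Fin 2) (p : unitInterval) (f : SlotOutcome (Fin 2) → ℝ≥0∞) (v : c.State → ℝ≥0∞) :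
    Prop :=
  ∀ x, ∫⁻ ξ, (f (c.outcome u x ξ.1) +
    {y | y ≠ SlotOutcome.success u}.indicator (fun _ => v (c.step x ξ)) (c.outcome u x ξ.1))
      ∂(c.noiseLaw p) = v x

lemma measurableSet_alive (u : Fin 2) (t : ℕ) : MeasurableSet {ω | c.Alive u t ω} :=
  measurableSet_setOfPred.2 ((c.measurable_alive_info u t).mono (c.info_le _) le_rfl)

lemma measurable_state_apply (t : ℕ) : Measurable fun ω => c.state ω t :=
  (c.measurable_state_info t).mono (c.info_le _) le_rfl

variable {c} {u : Fin 2} {p : unitInterval} {f : SlotOutcome (Fin 2) → ℝ≥0∞} {v : c.State → ℝ≥0∞}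

/-- This is the one-step equation integrated over the runs without a success so far; the indicator
in `IsValue` removes those that succeed in slot `t`. -/
lemma IsValue.setLIntegral_alive (hv : c.IsValue u p f v) (t : ℕ) :
    ∫⁻ ω in {ω | c.Alive u t ω}, v (c.state ω t) ∂(c.law p) =
      ∫⁻ ω in {ω | c.Alive u t ω}, f (c.trace u ω t) ∂(c.law p) +
        ∫⁻ ω in {ω | c.Alive u (t + 1) ω}, v (c.state ω (t + 1)) ∂(c.law p) := by
  classical
  have hf : Measurable fun ω => f (c.trace u ω t) :=
    (Measurable.of_discrete (f := f)).comp ((measurable_pi_apply t).comp (c.measurable_trace u))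
  rw [← lintegral_indicator (c.measurableSet_alive u t), ← lintegral_indicator
    (c.measurableSet_alive u t), ← lintegral_indicator (c.measurableSet_alive u (t + 1)),
    ← lintegral_add_left (hf.indicator (c.measurableSet_alive u t))]
  have key := c.lintegral_past_noise p t (Z := fun ω => (c.state ω t, c.Alive u t ω))
    ((c.measurable_state_info t).prodMk (c.measurable_alive_info u t))
    fun z ξ => if z.2 then f (c.outcome u z.1 ξ.1) + {y | y ≠ SlotOutcome.success u}.indicator
      (fun _ => v (c.step z.1 ξ)) (c.outcome u z.1 ξ.1) else 0
  trans ∫⁻ ω, ∫⁻ ξ, (if c.Alive u t ω then f (c.outcome u (c.state ω t) ξ.1) +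
    {y | y ≠ SlotOutcome.success u}.indicator (fun _ => v (c.step (c.state ω t) ξ))
      (c.outcome u (c.state ω t) ξ.1) else 0) ∂(c.noiseLaw p) ∂(c.law p)
  · refine lintegral_congr fun ω => ?_
    by_cases hω : c.Alive u t ω
    · simp only [if_pos hω]
      rw [Set.indicator_of_mem (by exact hω), hv]
    · simp only [if_neg hω]
      rw [Set.indicator_of_notMem (by exact hω), lintegral_zero]
  · rw [← key]
    refine lintegral_congr fun ω => ?_
    simp only [← trace_eq_outcome]
    by_cases hω : c.Alive u t ω <;> by_cases hsu : c.trace u ω t = .success u <;>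
      simp [Set.indicator, alive_succ, hω, hsu, state]

lemma IsValue.lintegral_eq_sum_add (hv : c.IsValue u p f v) (n : ℕ) :
    ∫⁻ ω, v (c.state ω 0) ∂(c.law p) =
      ∑ t ∈ Finset.range n, ∫⁻ ω in {ω | c.Alive u t ω}, f (c.trace u ω t) ∂(c.law p) +
        ∫⁻ ω in {ω | c.Alive u n ω}, v (c.state ω n) ∂(c.law p) := by
  induction n with
  | zero => simp [Alive]
  | succ n ih => rw [ih, Finset.sum_range_succ, add_assoc, ← hv.setLIntegral_alive]

variable (c u p f) in
lemma lintegral_successCost :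
    ∫⁻ e, Channel.successCost f u e ∂(c.traceLaw u p) =
      ∑' t, ∫⁻ ω in {ω | c.Alive u t ω}, f (c.trace u ω t) ∂(c.law p) := by
  rw [traceLaw, lintegral_map (Channel.measurable_successCost f u) (c.measurable_trace u)]
  have hf (t : ℕ) : Measurable fun ω => f (c.trace u ω t) :=
    (Measurable.of_discrete (f := f)).comp ((measurable_pi_apply t).comp (c.measurable_trace u))
  simp only [Channel.successCost, Channel.sumUntil]
  have h (t : ℕ) : ∫⁻ ω in {ω | c.Alive u t ω}, f (c.trace u ω t) ∂(c.law p) = _ :=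
    (lintegral_indicator (c.measurableSet_alive u t) _).symm
  simp only [h]
  rw [← lintegral_tsum fun t => ((hf t).indicator (c.measurableSet_alive u t)).aemeasurable]
  refine lintegral_congr fun ω => tsum_congr fun t => ?_
  by_cases hω : c.Alive u t ω
  · rw [Set.indicator_of_mem (by exact hω), Set.indicator_of_mem (by exact hω)]
  · rw [Set.indicator_of_notMem (by exact hω), Set.indicator_of_notMem (by exact hω)]

/-- The remainder is dropped. Applied to unit costs, this already gives the finite mean that later
makes the remainder vanish. -/
lemma IsValue.lintegral_successCost_le (hv : c.IsValue u p f v) :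
    ∫⁻ e, Channel.successCost f u e ∂(c.traceLaw u p) ≤ ∫⁻ ω, v (c.state ω 0) ∂(c.law p) := by
  rw [lintegral_successCost, ENNReal.tsum_eq_iSup_nat]
  exact iSup_le fun n => hv.lintegral_eq_sum_add n ▸ le_self_add

variable (c u p) in
lemma tendsto_measure_alive (h : ∫⁻ e, Channel.successCost (fun _ => 1) u e ∂(c.traceLaw u p) ≠ ∞) :
    Filter.Tendsto (fun t => c.law p {ω | c.Alive u t ω}) Filter.atTop (nhds 0) := by
  rw [lintegral_successCost] at h
  simp only [lintegral_one, Measure.restrict_apply_univ] at h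
  exact ENNReal.tendsto_atTop_zero_of_tsum_ne_top h

variable (c p) in
lemma ae_counter_le (t : ℕ) : ∀ᵐ ω ∂(c.law p), (c.state ω t).2 ≤ c.CWmax := by
  have hdraw (t : ℕ) : ∀ᵐ ω ∂(c.law p), ∀ i, (ω t).2 i ≤ c.CWmax := by
    have h1 : ∀ᵐ ξ ∂(c.noiseLaw p), ∀ i, ξ.2 i ≤ c.CWmax := by
      refine ae_all_iff.2 fun i => ?_
      have h2 : ∀ᵐ n ∂(uniformOn (Set.Icc 1 (c.cw i))), n ≤ c.CWmax := by
        have := ae_cond_mem (μ := (Measure.count : Measure ℕ)) (Set.finite_Icc 1 (c.cw i)).measurableSet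
        filter_upwards [this] with n hn using hn.2.trans (min_le_right _ _)
      exact (Measure.quasiMeasurePreserving_snd.ae
        ((measurePreserving_eval (fun i : Fin (c.β + 1) => uniformOn (Set.Icc 1 (c.cw i))) i)
          |>.quasiMeasurePreserving.ae h2))
    exact (measurePreserving_eval_infinitePi (fun _ => c.noiseLaw p) t).quasiMeasurePreserving.ae h1
  induction t with
  | zero => filter_upwards [hdraw 0] with ω h using h 0
  | succ t ih =>
    filter_upwards [hdraw (t + 1), ih] with ω h h'
    simp only [state, step]
    split_ifs
    · exact h _
    · exact h _
    · exact (Nat.sub_le _ _).trans h'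

/-- Counters almost surely stay below `CWmax`, where `v ≤ C`, so the remainder is at most `C` times
the probability of no success so far, which tends to `0`. -/
lemma IsValue.lintegral_successCost_eq (hv : c.IsValue u p f v) {C : ℝ≥0∞} (hC : C ≠ ∞)
    (hvC : ∀ x : c.State, x.2 ≤ c.CWmax → v x ≤ C)
    (h : ∫⁻ e, Channel.successCost (fun _ => 1) u e ∂(c.traceLaw u p) ≠ ∞) :
    ∫⁻ e, Channel.successCost f u e ∂(c.traceLaw u p) = ∫⁻ ω, v (c.state ω 0) ∂(c.law p) := by
  have hrem : Filter.Tendsto (fun n => ∫⁻ ω in {ω | c.Alive u n ω}, v (c.state ω n) ∂(c.law p))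
      Filter.atTop (nhds 0) := by
    have hlim := ENNReal.Tendsto.const_mul (a := C) (tendsto_measure_alive c u p h) (.inr hC)
    rw [mul_zero] at hlim
    refine tendsto_of_tendsto_of_tendsto_of_le_of_le tendsto_const_nhds hlim (fun _ => zero_le)
      fun n => ?_
    have : ∫⁻ ω in {ω | c.Alive u n ω}, v (c.state ω n) ∂(c.law p) ≤
        ∫⁻ ω in {ω | c.Alive u n ω}, C ∂(c.law p) := by
      refine lintegral_mono_ae (ae_restrict_of_ae ?_)
      filter_upwards [c.ae_counter_le p n] with ω hω using hvC _ hω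
    rwa [setLIntegral_const] at this
  rw [lintegral_successCost]
  have hsum := (ENNReal.tendsto_nat_tsum fun t =>
    ∫⁻ ω in {ω | c.Alive u t ω}, f (c.trace u ω t) ∂(c.law p)).add hrem
  simp only [← hv.lintegral_eq_sum_add, add_zero] at hsum
  exact tendsto_nhds_unique hsum tendsto_const_nhds

end CSMA

end

noncomputable section

namespace CSMA

variable (c : CSMA)

open scoped ENNReal

/-! ### Mean backoff and the explicit value function -/

lemma cw_of_le {i : ℕ} (h : i ≤ c.β) : c.cw i = 2 ^ i * c.CWmin :=
  min_eq_left (Nat.mul_le_mul_right _ (Nat.pow_le_pow_right two_pos h))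

lemma cw_of_ge {i : ℕ} (h : c.β ≤ i) : c.cw i = c.CWmax :=
  min_eq_right (Nat.mul_le_mul_right _ (Nat.pow_le_pow_right two_pos h))

lemma cw_min (i : ℕ) : c.cw (min i c.β) = c.cw i := by
  rcases le_total i c.β with h | h
  · rw [min_eq_left h]
  · rw [min_eq_right h, c.cw_of_ge h, c.cw_of_ge le_rfl]

lemma meanCounter_pos (i : ℕ) : 0 < c.meanCounter i := by unfold meanCounter; positivity

lemma meanCounter_of_le {i : ℕ} (h : i ≤ c.β) : c.meanCounter i = (1 + 2 ^ i * c.CWmin) / 2 := by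
  rw [meanCounter, c.cw_of_le h]; push_cast; ring

/-- The mean of the sum of all counters that are drawn for a packet from stage `i` on, if each
transmission collides with probability `p`. -/
def meanBackoff (p : ℝ) (i : ℕ) : ℝ :=
  ∑ k ∈ Finset.range (c.β - i), p ^ k * c.meanCounter (i + k) +
    p ^ (c.β - i) / (1 - p) * c.meanCounter c.β

/-- Truncated subtraction makes `meanBackoff` constant from stage `β` on, in accordance with the
capped stages. -/
lemma meanBackoff_min (p : ℝ) (i : ℕ) : c.meanBackoff p (min i c.β) = c.meanBackoff p i := by
  rcases le_total i c.β with h | h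
  · rw [min_eq_left h]
  · rw [min_eq_right h, meanBackoff, meanBackoff, Nat.sub_self, Nat.sub_eq_zero_of_le h]
    simp

/-- The first draw is split off. From stage `β` on, with mean counter m, this reads m / (1 - p) = m
+ p m / (1 - p), which needs `p ≠ 1`. -/
lemma meanBackoff_eq {p : ℝ} (hp : p ≠ 1) (i : ℕ) :
    c.meanBackoff p i = c.meanCounter i + p * c.meanBackoff p (i + 1) := by
  have h1 : 1 - p ≠ 0 := sub_ne_zero.2 hp.symm
  rcases lt_or_ge i c.β with h | h
  · obtain ⟨n, hn⟩ := Nat.exists_eq_add_of_lt h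
    rw [meanBackoff, meanBackoff, show c.β - i = n + 1 by omega, show c.β - (i + 1) = n by omega,
      Finset.sum_range_succ', mul_add, Finset.mul_sum]
    have : ∀ k, p ^ (k + 1) * c.meanCounter (i + (k + 1)) =
        p * (p ^ k * c.meanCounter (i + 1 + k)) := fun k => by
      rw [show i + (k + 1) = i + 1 + k by omega]; ring
    simp only [this]
    rw [pow_zero, add_zero, one_mul]
    ring
  · rw [meanBackoff, meanBackoff, Nat.sub_eq_zero_of_le h, Nat.sub_eq_zero_of_le (h.trans i.le_succ),
      meanCounter, meanCounter, c.cw_of_ge h, c.cw_of_ge le_rfl]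
    simp only [Finset.range_zero, Finset.sum_empty, pow_zero]
    field_simp
    ring

lemma meanBackoff_nonneg {p : ℝ} (h₀ : 0 ≤ p) (h₁ : p ≤ 1) (i : ℕ) : 0 ≤ c.meanBackoff p i := by
  have := sub_nonneg.2 h₁
  have h i := (c.meanCounter_pos i).le
  have := h c.β
  exact add_nonneg (Finset.sum_nonneg fun k _ => mul_nonneg (by positivity) (h _)) (by positivity)

lemma val_nextStage (i : Fin (c.β + 1)) : (c.nextStage i : ℕ) = min ((i : ℕ) + 1) c.β := rfl

section Value

variable (u : Fin 2) (p : unitInterval) (g : SlotOutcome (Fin 2) → ℝ)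

/-- The mean cost of a slot in which user `u` does not transmit. -/
def waitCost : ℝ := p * g (.success (1 - u)) + (1 - p) * g .idle

/-- The mean cost of a slot in which user `u` transmits. -/
def accessCost : ℝ := p * g .collision + (1 - p) * g (.success u)

/-- The mean cost until the next success of user `u` as a function of its state. -/
def value (x : c.State) : ℝ :=
  x.2 * waitCost u p g +
    (accessCost u p g / (1 - p) + waitCost u p g * (p * c.meanBackoff p (x.1 + 1)))

variable {u p g}

lemma waitCost_nonneg (hg : ∀ x, 0 ≤ g x) : 0 ≤ waitCost u p g :=
  add_nonneg (mul_nonneg p.2.1 (hg _)) (mul_nonneg (sub_nonneg.2 p.2.2) (hg _))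

lemma accessCost_nonneg (hg : ∀ x, 0 ≤ g x) : 0 ≤ accessCost u p g :=
  add_nonneg (mul_nonneg p.2.1 (hg _)) (mul_nonneg (sub_nonneg.2 p.2.2) (hg _))

variable {c}

lemma value_offset_nonneg (hg : ∀ x, 0 ≤ g x) (i : ℕ) :
    0 ≤ accessCost u p g / (1 - p) + waitCost u p g * (p * c.meanBackoff p i) :=
  add_nonneg (div_nonneg (accessCost_nonneg hg) (sub_nonneg.2 p.2.2))
    (mul_nonneg (waitCost_nonneg hg) (mul_nonneg p.2.1 (c.meanBackoff_nonneg p.2.1 p.2.2 _)))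

lemma value_nonneg (hg : ∀ x, 0 ≤ g x) (x : c.State) : 0 ≤ c.value u p g x :=
  add_nonneg (mul_nonneg (Nat.cast_nonneg _) (waitCost_nonneg hg)) (value_offset_nonneg hg _)

/-- With a positive counter the slot costs `waitCost` on average and the counter drops by one. With
counter `0` it costs `accessCost`, and a collision leads to a new counter in the next stage; the
recursion of `meanBackoff` closes the equation. -/
lemma isValue_value (hp : (p : ℝ) ≠ 1) (hg : ∀ x, 0 ≤ g x) :
    c.IsValue u p (fun x => ENNReal.ofReal (g x)) fun x => ENNReal.ofReal (c.value u p g x) := by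
  rintro ⟨i, n⟩
  have hp0 : (0 : ℝ) ≤ p := p.2.1
  have hp1 : (0 : ℝ) ≤ 1 - p := sub_nonneg.2 p.2.2
  have hu : 1 - u ≠ u := by omega
  have h1p : (1 : ℝ) - p ≠ 0 := sub_ne_zero.2 hp.symm
  cases n with
  | zero =>
    obtain ⟨F, hFdef⟩ : ∃ F : Bool → ℕ → ℝ≥0∞, F = fun b n => if b then
      ENNReal.ofReal (g .collision) + ENNReal.ofReal (c.value u p g (c.nextStage i, n)) else
      ENNReal.ofReal (g (.success u)) := ⟨_, rfl⟩
    have hF (ξ : c.Noise) : ENNReal.ofReal (g (c.outcome u (i, 0) ξ.1)) +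
        {y | y ≠ SlotOutcome.success u}.indicator
          (fun _ => ENNReal.ofReal (c.value u p g (c.step (i, 0) ξ))) (c.outcome u (i, 0) ξ.1) =
        F ξ.1 (ξ.2 (c.nextStage i)) := by
      obtain ⟨b, d⟩ := ξ
      cases b <;> simp [hFdef, outcome, step]
    rw [lintegral_congr hF, lintegral_noiseLaw, hFdef]
    simp only [if_true, Bool.false_eq_true, if_false, lintegral_const, measure_univ, mul_one]
    rw [lintegral_add_left measurable_const, lintegral_const, measure_univ, mul_one]
    simp only [value]
    rw [c.lintegral_counter _ (waitCost_nonneg hg) (value_offset_nonneg hg _),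
      ← ENNReal.ofReal_add (hg _), ← ENNReal.ofReal_mul hp0, ← ENNReal.ofReal_mul hp1,
      ← ENNReal.ofReal_add]
    · congr 1
      -- The chain caps the stage at `β`, the formulas do not; both give the same values.
      have e1 : c.meanCounter (c.nextStage i) = c.meanCounter (i + 1) := by
        rw [meanCounter, meanCounter, val_nextStage, cw_min]
      have e2 : c.meanBackoff p ((c.nextStage i : ℕ) + 1) = c.meanBackoff p (i + 1 + 1) := by
        rw [val_nextStage, ← meanBackoff_min, ← c.meanBackoff_min _ (i + 1 + 1)]
        congr 1; omega
      rw [e1, e2, c.meanBackoff_eq hp (i + 1), accessCost]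
      field_simp
      push_cast
      ring
    · exact mul_nonneg hp0 (add_nonneg (hg _) (add_nonneg (mul_nonneg (c.meanCounter_pos _).le
        (waitCost_nonneg hg)) (value_offset_nonneg hg _)))
    · exact mul_nonneg hp1 (hg _)
    · exact add_nonneg (mul_nonneg (c.meanCounter_pos _).le (waitCost_nonneg hg))
        (value_offset_nonneg hg _)
  | succ n =>
    obtain ⟨F, hFdef⟩ : ∃ F : Bool → ℕ → ℝ≥0∞, F = fun b _ =>
      ENNReal.ofReal (g (if b then .success (1 - u) else .idle)) +
        ENNReal.ofReal (c.value u p g (i, n)) := ⟨_, rfl⟩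
    have hF (ξ : c.Noise) : ENNReal.ofReal (g (c.outcome u (i, n + 1) ξ.1)) +
        {y | y ≠ SlotOutcome.success u}.indicator
          (fun _ => ENNReal.ofReal (c.value u p g (c.step (i, n + 1) ξ)))
          (c.outcome u (i, n + 1) ξ.1) =
        F ξ.1 (ξ.2 i) := by
      obtain ⟨b, d⟩ := ξ
      cases b <;> simp [hFdef, outcome, step, hu]
    rw [lintegral_congr hF, lintegral_noiseLaw, hFdef]
    simp only [if_true, Bool.false_eq_true, if_false, lintegral_const, measure_univ, mul_one]
    rw [← ENNReal.ofReal_add (hg _) (value_nonneg hg _), ← ENNReal.ofReal_add (hg _)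
      (value_nonneg hg _), ← ENNReal.ofReal_mul hp0, ← ENNReal.ofReal_mul hp1,
      ← ENNReal.ofReal_add]
    · congr 1
      simp only [value, waitCost]
      push_cast
      ring
    · exact mul_nonneg hp0 (add_nonneg (hg _) (value_nonneg hg _))
    · exact mul_nonneg hp1 (add_nonneg (hg _) (value_nonneg hg _))

lemma lintegral_value_zero (hp : (p : ℝ) ≠ 1) (hg : ∀ x, 0 ≤ g x) :
    ∫⁻ ω, ENNReal.ofReal (c.value u p g (c.state ω 0)) ∂(c.law p) =
      ENNReal.ofReal (waitCost u p g * c.meanBackoff p 0 + accessCost u p g / (1 - p)) := by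
  have h := (measurePreserving_eval_infinitePi (fun _ => c.noiseLaw p) 0).lintegral_comp
    (f := fun ξ : c.Noise => ENNReal.ofReal (c.value u p g (0, ξ.2 0))) .of_discrete
  have h' := c.lintegral_noiseLaw p 0 fun _ n => ENNReal.ofReal (c.value u p g (0, n))
  rw [← add_mul, ← ENNReal.ofReal_add p.2.1 (sub_nonneg.2 p.2.2), add_sub_cancel,
    ENNReal.ofReal_one, one_mul] at h'
  refine (h.trans h').trans ?_
  simp only [value]
  rw [c.lintegral_counter _ (waitCost_nonneg hg) (value_offset_nonneg hg _)]
  congr 1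
  rw [c.meanBackoff_eq hp 0, Fin.val_zero]
  ring

variable (c u) in
lemma lintegral_successCost_one_ne_top (hp : (p : ℝ) ≠ 1) :
    ∫⁻ e, Channel.successCost (fun _ => 1) u e ∂(c.traceLaw u p) ≠ ∞ := by
  have h := (isValue_value (c := c) (u := u) (g := fun _ => 1) hp
    fun _ => zero_le_one).lintegral_successCost_le
  rw [lintegral_value_zero hp fun _ => zero_le_one] at h
  simp only [ENNReal.ofReal_one] at h
  exact ne_top_of_le_ne_top ENNReal.ofReal_ne_top h

variable (c u) in
/-- The mean cost between two consecutive successes of a user. -/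
lemma lintegral_successCost_ofReal (hp : (p : ℝ) ≠ 1) (hg : ∀ x, 0 ≤ g x) :
    ∫⁻ e, Channel.successCost (fun x => ENNReal.ofReal (g x)) u e ∂(c.traceLaw u p) =
      ENNReal.ofReal (waitCost u p g * c.meanBackoff p 0 + accessCost u p g / (1 - p)) := by
  rw [← lintegral_value_zero hp hg]
  have hfin : (Set.univ ×ˢ Set.Iic c.CWmax : Set c.State).Finite :=
    Set.finite_univ.prod (Set.finite_Iic _)
  refine (isValue_value hp hg).lintegral_successCost_eq
    (C := ∑ x ∈ hfin.toFinset, ENNReal.ofReal (c.value u p g x))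
    (ENNReal.sum_ne_top.2 fun _ _ => ENNReal.ofReal_ne_top) (fun x hx => ?_)
    (lintegral_successCost_one_ne_top c u hp)
  exact Finset.single_le_sum (f := fun x => ENNReal.ofReal (c.value u p g x))
    (fun _ _ => zero_le) (by simpa using hx)

end Value

/-- The first counter is at least `1`, so `u` is silent in slot `0`, where the other user transmits,
and thus succeeds, with probability `p > 0`. -/
lemma traceLaw_otherFirst_ne_zero (u : Fin 2) {p : unitInterval} (hp : p ≠ 0) :
    c.traceLaw u p {e | Channel.OtherFirst u e} ≠ 0 := by
  rw [traceLaw, Measure.map_apply (c.measurable_trace u) (Channel.measurableSet_otherFirst u)]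
  have hdraw : ∀ᵐ ω ∂(c.law p), (ω 0).2 0 ≠ 0 := by
    have h := (measurePreserving_eval_infinitePi (fun _ => c.noiseLaw p) 0).quasiMeasurePreserving.ae
      (p := fun ξ => ξ.2 0 ≠ 0) ?_
    · exact h
    · have h2 : ∀ᵐ n ∂(uniformOn (Set.Icc 1 (c.cw (0 : Fin (c.β + 1))))), n ≠ 0 := by
        have := ae_cond_mem (μ := (Measure.count : Measure ℕ))
          (Set.finite_Icc 1 (c.cw (0 : Fin (c.β + 1)))).measurableSet
        filter_upwards [this] with n hn using Nat.one_le_iff_ne_zero.1 hn.1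
      exact Measure.quasiMeasurePreserving_snd.ae
        ((measurePreserving_eval (fun i : Fin (c.β + 1) => uniformOn (Set.Icc 1 (c.cw i))) 0)
          |>.quasiMeasurePreserving.ae h2)
  have hbit : c.law p {ω | (ω 1).1 = true} = ENNReal.ofReal p := by
    have h := (measurePreserving_eval_infinitePi (fun _ => c.noiseLaw p) 1).measure_preimage
      (s := {ξ : c.Noise | ξ.1 = true}) MeasurableSet.of_discrete.nullMeasurableSet
    refine h.trans ?_
    have h2 := c.lintegral_noiseLaw p 0 fun b _ => if b then 1 else 0
    simp only [if_true, Bool.false_eq_true, if_false, lintegral_one, measure_univ, mul_one,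
      lintegral_zero, mul_zero, add_zero] at h2
    rw [← h2, ← lintegral_indicator_one .of_discrete]
    simp only [Set.indicator, Set.mem_ofPred_eq, Pi.one_apply]
  have hle : c.law p {ω | (ω 1).1 = true} ≤
      c.law p (c.trace u ⁻¹' {e | Channel.OtherFirst u e}) := by
    refine measure_mono_ae ?_
    filter_upwards [hdraw] with ω h0 h1
    exact ⟨0, c.trace_eq_success_other_iff.2 ⟨h0, h1⟩, fun r hr => absurd hr r.not_lt_zero⟩
  rw [hbit] at hle
  refine ((ENNReal.ofReal_pos.2 ?_).trans_le hle).ne'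
  exact lt_of_le_of_ne p.2.1 fun h => hp (Subtype.ext h.symm)

end CSMA

end

noncomputable section

namespace CSMA

variable (c : CSMA)

open scoped ENNReal

/-! ### The recursive equation -/

/-- `p` solves the recursive equation iff this increasing function of `p` equals `2`. -/
def balance (p : ℝ) : ℝ :=
  p * (c.CWmin + 3 + p * c.CWmin * ∑ i ∈ Finset.range c.β, (2 * p) ^ i)

lemma one_le_CWmin : (1 : ℝ) ≤ c.CWmin := by exact_mod_cast c.CWmin_pos

lemma solvesRecursion_iff (hCW : 2 ≤ c.CWmax) {p : ℝ} (hp : 0 ≤ p) :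
    c.SolvesRecursion p ↔ c.balance p = 2 := by
  have hC := c.one_le_CWmin
  have hg := mul_neg_geom_sum (2 * p) c.β
  have hS : 0 ≤ ∑ i ∈ Finset.range c.β, (2 * p) ^ i := Finset.sum_nonneg fun i _ => by positivity
  have hD : (1 - 2 * p) * (c.CWmin + 3) + p * c.CWmin * (1 - (2 * p) ^ c.β) =
      (1 - 2 * p) * (c.CWmin + 3 + p * c.CWmin * ∑ i ∈ Finset.range c.β, (2 * p) ^ i) := by
    rw [← hg]; ring
  have hE : 0 < (c.CWmin : ℝ) + 3 + p * c.CWmin * ∑ i ∈ Finset.range c.β, (2 * p) ^ i := by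
    positivity
  rw [SolvesRecursion, hD, balance]
  by_cases h : 1 - 2 * p = 0
  -- Here the denominator vanishes, so `balance` must differ from `2`. Equality would force `CWmin =
  -- 1` and `β = 0`, against `2 ≤ CWmax`.
  · obtain rfl : p = 1 / 2 := by linarith
    norm_num
    intro h2
    have hβ : c.β = 0 := by
      by_contra hβ
      have : (1 : ℝ) ≤ c.β := by exact_mod_cast Nat.one_le_iff_ne_zero.2 hβ
      nlinarith
    rw [CWmax, hβ, pow_zero, one_mul] at hCW
    have : (2 : ℝ) ≤ c.CWmin := by exact_mod_cast hCW
    rw [hβ] at h2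
    norm_num at h2
    linarith
  · generalize (c.CWmin : ℝ) + 3 + p * c.CWmin * ∑ i ∈ Finset.range c.β, (2 * p) ^ i = E at hE
    rw [mul_comm 2 (1 - 2 * p), mul_div_mul_left _ _ h, eq_div_iff hE.ne',
      and_iff_right (mul_ne_zero h hE.ne')]

lemma strictMonoOn_balance : StrictMonoOn c.balance (Set.Ici 0) := by
  intro p hp q hq hpq
  rw [Set.mem_Ici] at hp hq
  have hC := c.one_le_CWmin
  have hs : ∑ i ∈ Finset.range c.β, (2 * p) ^ i ≤ ∑ i ∈ Finset.range c.β, (2 * q) ^ i :=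
    Finset.sum_le_sum fun i _ => pow_le_pow_left₀ (by positivity) (by linarith) i
  have hS : 0 ≤ ∑ i ∈ Finset.range c.β, (2 * p) ^ i := Finset.sum_nonneg fun i _ => by positivity
  unfold balance
  refine mul_lt_mul hpq ?_ (by positivity) hq
  gcongr

lemma existsUnique_balance : ∃! p : unitInterval, c.balance p = 2 := by
  have hcont : Continuous c.balance := by unfold balance; fun_prop
  have hC := c.one_le_CWmin
  have h1 : 2 ≤ c.balance 1 := by
    have hS : 0 ≤ ∑ i ∈ Finset.range c.β, (2 * (1 : ℝ)) ^ i :=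
      Finset.sum_nonneg fun i _ => by positivity
    have := mul_nonneg (zero_le_one.trans hC) hS
    simp only [balance, one_mul] at *
    linarith
  obtain ⟨p, hp, h⟩ := intermediate_value_Icc zero_le_one hcont.continuousOn
    (show (2 : ℝ) ∈ Set.Icc (c.balance 0) (c.balance 1) from ⟨by simp [balance], h1⟩)
  refine ⟨⟨p, hp⟩, h, fun q hq => Subtype.ext ?_⟩
  exact c.strictMonoOn_balance.injOn q.2.1 hp.1 (hq.trans h.symm)

/-- On average a packet needs `1 / (1 - p)` transmissions and `meanBackoff p 0` waiting slots. Hence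
`1 + (1 - p) * meanBackoff p 0` is the mean number of slots per transmission, and `balance p = 2`
says that `p` is its inverse. -/
lemma balance_eq {p : ℝ} (hp : p ≠ 1) :
    c.balance p = 2 * (p * (1 + (1 - p) * c.meanBackoff p 0)) := by
  have h1 : 1 - p ≠ 0 := sub_ne_zero.2 hp.symm
  have hg := mul_neg_geom_sum (2 * p) c.β
  have hg' := mul_neg_geom_sum p c.β
  have hsum : ∑ k ∈ Finset.range c.β, p ^ k * c.meanCounter (0 + k) =
      (∑ k ∈ Finset.range c.β, p ^ k + c.CWmin * ∑ k ∈ Finset.range c.β, (2 * p) ^ k) / 2 := by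
    rw [Finset.mul_sum, ← Finset.sum_add_distrib, Finset.sum_div]
    refine Finset.sum_congr rfl fun k hk => ?_
    rw [zero_add, c.meanCounter_of_le (Finset.mem_range.1 hk).le, mul_pow]
    ring
  rw [meanBackoff, Nat.sub_zero, hsum, c.meanCounter_of_le le_rfl, balance]
  generalize ∑ k ∈ Finset.range c.β, (2 * p) ^ k = S at *
  generalize ∑ k ∈ Finset.range c.β, p ^ k = R at *
  rw [mul_pow] at hg
  field_simp
  linear_combination (-p) * hg' + (-p * c.CWmin) * hg

/-! ### Stationary distributions of the backoff chain -/

/-- The probability that the counter drawn in stage `i` equals `n`. -/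
def drawProb (i n : ℕ) : ℝ := if n ∈ Finset.Icc 1 (c.cw i) then (c.cw i : ℝ)⁻¹ else 0

/-- The probability that the counter drawn in stage `i` is at least `n`. -/
def drawTail (i n : ℕ) : ℝ := if n = 0 then 1 else ((c.cw i + 1 - n : ℕ) : ℝ) / c.cw i

lemma drawTail_nonneg (i n : ℕ) : 0 ≤ c.drawTail i n := by
  unfold drawTail; split_ifs <;> positivity

lemma drawTail_eq (i n : ℕ) : c.drawTail i n = c.drawTail i (n + 1) + c.drawProb i n := by
  have hc : (c.cw i : ℝ) ≠ 0 := by exact_mod_cast (c.cw_pos i).ne'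
  unfold drawTail drawProb
  rcases n.eq_zero_or_pos with rfl | hn
  · simp [hc]
  · simp only [hn.ne', if_false, Finset.mem_Icc, Nat.succ_ne_zero, Nat.one_le_iff_ne_zero, ne_eq,
      not_false_eq_true, true_and]
    split_ifs with h
    · rw [Nat.cast_sub (by omega), Nat.cast_sub (by omega)]
      push_cast
      field_simp
      ring
    · simp [show c.cw i + 1 - n = 0 by omega, show c.cw i + 1 - (n + 1) = 0 by omega]

lemma drawTail_eq_zero {i n : ℕ} (h : c.cw i < n) : c.drawTail i n = 0 := by
  simp [drawTail, show n ≠ 0 by omega, show c.cw i + 1 - n = 0 by omega]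

/-- Tail-sum formula for the mean; the additional `1` is the term `n = 0`. -/
lemma sum_drawTail (i : ℕ) :
    ∑ n ∈ Finset.range (c.cw i + 1), c.drawTail i n = 1 + c.meanCounter i := by
  have hc : (c.cw i : ℝ) ≠ 0 := by exact_mod_cast (c.cw_pos i).ne'
  have h (N M : ℕ) : ∑ k ∈ Finset.range M, ((N : ℝ) - k) = M * N - M * (M - 1) / 2 := by
    induction M with
    | zero => simp
    | succ M ih => rw [Finset.sum_range_succ, ih]; push_cast; ring
  rw [Finset.sum_range_succ', add_comm]
  have h' : ∑ n ∈ Finset.range (c.cw i), c.drawTail i (n + 1) =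
      (∑ k ∈ Finset.range (c.cw i), ((c.cw i : ℝ) - k)) / c.cw i := by
    rw [Finset.sum_div]
    refine Finset.sum_congr rfl fun k hk => ?_
    rw [Finset.mem_range] at hk
    rw [drawTail, if_neg k.succ_ne_zero, Nat.cast_sub (by omega)]
    push_cast
    ring
  rw [h', h, drawTail, if_pos rfl, meanCounter]
  field_simp
  ring

/-- The probability that a user that has just transmitted in stage `j` enters stage `i`. -/
def stageProb (p : ℝ) (j i : Fin (c.β + 1)) : ℝ :=
  (if c.nextStage j = i then p else 0) + if 0 = i then 1 - p else 0

lemma stageProb_nonneg (p : unitInterval) (j i : Fin (c.β + 1)) : 0 ≤ c.stageProb p j i := by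
  have := p.2.1; have := sub_nonneg.2 p.2.2
  unfold stageProb; split_ifs <;> linarith

lemma uniformOn_singleton_eq (i n : ℕ) :
    uniformOn (Set.Icc 1 (c.cw i)) {n} = ENNReal.ofReal (c.drawProb i n) := by
  have hc : (0 : ℝ) < c.cw i := by exact_mod_cast c.cw_pos i
  have h := lintegral_uniformOn_Icc (c.cw i) (({n} : Set ℕ).indicator 1)
  rw [lintegral_indicator_one (measurableSet_singleton n)] at h
  rw [h, drawProb]
  simp only [Set.indicator, Set.mem_singleton_iff, Pi.one_apply, Finset.sum_ite_eq']
  split_ifs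
  · rw [mul_one, ENNReal.ofReal_inv_of_pos hc, ENNReal.ofReal_natCast]
  · simp

lemma noiseLaw_step_zero (p : unitInterval) (j i : Fin (c.β + 1)) (n : ℕ) :
    c.noiseLaw p {ξ | c.step (j, 0) ξ = (i, n)} =
      ENNReal.ofReal (c.stageProb p j i * c.drawProb i n) := by
  have hp0 : (0 : ℝ) ≤ p := p.2.1
  have hp1 : (0 : ℝ) ≤ 1 - p := sub_nonneg.2 p.2.2
  obtain ⟨F, hF⟩ : ∃ F : Bool → ℕ → ℝ≥0∞, F = fun b m =>
    if (if b then c.nextStage j else 0) = i then ({n} : Set ℕ).indicator 1 m else 0 := ⟨_, rfl⟩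
  have h (ξ : c.Noise) : {ξ | c.step (j, 0) ξ = (i, n)}.indicator 1 ξ = F ξ.1 (ξ.2 i) := by
    obtain ⟨b, d⟩ := ξ
    simp only [hF, Set.indicator, Set.mem_ofPred_eq, step, if_true, Prod.mk.injEq,
      Set.mem_singleton_iff, Pi.one_apply]
    split_ifs <;> simp_all
  rw [← lintegral_indicator_one .of_discrete, lintegral_congr h, lintegral_noiseLaw, hF]
  have hd : 0 ≤ c.drawProb i n := by unfold drawProb; split_ifs <;> positivity
  rw [stageProb, add_mul, ENNReal.ofReal_add, ENNReal.ofReal_mul, ENNReal.ofReal_mul,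
    ← uniformOn_singleton_eq]
  · simp only [if_true, Bool.false_eq_true, if_false]
    have hi : ∫⁻ m, ({n} : Set ℕ).indicator 1 m ∂(uniformOn (Set.Icc 1 (c.cw i))) = _ :=
      lintegral_indicator_one (measurableSet_singleton n)
    congr 1 <;> split_ifs <;>
      simp only [hi, lintegral_zero, ENNReal.ofReal_zero, mul_zero, zero_mul]
  all_goals split_ifs <;> positivity

/-- State `(i, n)` is entered either by decrementing the counter in `(i, n + 1)` or by a draw after
a transmission in some stage `j`. -/
lemma map_step_singleton (π : Measure c.State) [SFinite π] (p : unitInterval)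
    (i : Fin (c.β + 1)) (n : ℕ) :
    (π.prod (c.noiseLaw p)).map (fun z => c.step z.1 z.2) {(i, n)} =
      π {(i, n + 1)} + ∑ j, ENNReal.ofReal (c.stageProb p j i * c.drawProb i n) * π {(j, 0)} := by
  rw [Measure.map_apply .of_discrete .of_discrete, Measure.prod_apply .of_discrete,
    lintegral_countable', ENNReal.tsum_prod', tsum_fintype]
  have h (j : Fin (c.β + 1)) : ∑' m : ℕ, c.noiseLaw p (Prod.mk ((j, m) : c.State) ⁻¹'
      ((fun z : c.State × c.Noise => c.step z.1 z.2) ⁻¹' {(i, n)})) * π {(j, m)} =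
      (if j = i then π {(i, n + 1)} else 0) +
        ENNReal.ofReal (c.stageProb p j i * c.drawProb i n) * π {(j, 0)} := by
    rw [tsum_eq_zero_add' ENNReal.summable, add_comm, ← c.noiseLaw_step_zero]
    congr 1
    have h' (m : ℕ) : (Prod.mk ((j, m + 1) : c.State) ⁻¹'
        ((fun z : c.State × c.Noise => c.step z.1 z.2) ⁻¹' {(i, n)})) =
        if j = i ∧ m = n then Set.univ else ∅ := by
      ext ξ
      split_ifs with hjm <;> simp [step, hjm]
    simp only [h']
    by_cases hji : j = i
    · rw [tsum_eq_single n]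
      · simp [hji]
      · intro m hm; simp [hm]
    · simp [hji]
  simp only [h]
  rw [Finset.sum_add_distrib, Finset.sum_ite_eq' Finset.univ i, if_pos (Finset.mem_univ _)]

end CSMA

end

noncomputable section

namespace CSMA

variable (c : CSMA)

open scoped ENNReal

/-- The rate at which stage `i` is entered, if stage `j` is left with rate `T j`. -/
def entryRate (p : ℝ) (T : Fin (c.β + 1) → ℝ) (i : Fin (c.β + 1)) : ℝ :=
  ∑ j, T j * c.stageProb p j i

lemma isStationary_iff (π : Measure c.State) [IsFiniteMeasure π] (p : unitInterval) :
    (π.prod (c.noiseLaw p)).map (fun z => c.step z.1 z.2) = π ↔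
      ∀ i n, π.real {(i, n)} = π.real {(i, n + 1)} +
        c.entryRate p (fun j => π.real {(j, 0)}) i * c.drawProb i n := by
  have hd (i n : ℕ) : 0 ≤ c.drawProb i n := by unfold drawProb; split_ifs <;> positivity
  have key (i : Fin (c.β + 1)) (n : ℕ) :
      ((π.prod (c.noiseLaw p)).map (fun z => c.step z.1 z.2) {(i, n)}).toReal =
        π.real {(i, n + 1)} + c.entryRate p (fun j => π.real {(j, 0)}) i * c.drawProb i n := by
    rw [map_step_singleton, ENNReal.toReal_add (measure_ne_top _ _)
      (ENNReal.sum_ne_top.2 fun j _ => ENNReal.mul_ne_top ENNReal.ofReal_ne_top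
      (measure_ne_top _ _)), ENNReal.toReal_sum fun j _ => ENNReal.mul_ne_top
      ENNReal.ofReal_ne_top (measure_ne_top _ _), entryRate, Finset.sum_mul]
    refine congrArg₂ _ rfl (Finset.sum_congr rfl fun j _ => ?_)
    rw [ENNReal.toReal_mul, ENNReal.toReal_ofReal (mul_nonneg (c.stageProb_nonneg p j i) (hd _ _)),
      measureReal_def]
    ring
  constructor
  · intro h i n
    rw [← key, h, measureReal_def]
  · intro h
    refine Measure.ext_of_singleton fun x => ?_
    rw [← ENNReal.toReal_eq_toReal_iff' (measure_ne_top _ _) (measure_ne_top _ _)]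
    exact (key x.1 x.2).trans (h x.1 x.2).symm

lemma sum_entryRate_mul (p : ℝ) (T : Fin (c.β + 1) → ℝ) (F : Fin (c.β + 1) → ℝ) :
    ∑ i, c.entryRate p T i * F i = ∑ j, T j * (p * F (c.nextStage j) + (1 - p) * F 0) := by
  simp only [entryRate, Finset.sum_mul]
  rw [Finset.sum_comm]
  refine Finset.sum_congr rfl fun j _ => ?_
  simp only [stageProb, mul_assoc, add_mul, ite_mul, zero_mul, ← Finset.mul_sum,
    Finset.sum_add_distrib, Finset.sum_ite_eq, Finset.mem_univ, if_true]

/-- If the rates of leaving and of entering the stages agree, the mean number of backoff slots is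
governed by the total rate. -/
lemma sum_mul_meanCounter {p : ℝ} (hp : p ≠ 1) {T : Fin (c.β + 1) → ℝ}
    (hT : ∀ i, c.entryRate p T i = T i) :
    ∑ i, T i * (1 + c.meanCounter i) = (∑ i, T i) * (1 + (1 - p) * c.meanBackoff p 0) := by
  -- `meanBackoff` acts as a potential: testing the balance of rates against it gives the sum
  -- without solving for `T`.
  have h := c.sum_entryRate_mul p T fun i => c.meanBackoff p i
  simp only [hT] at h
  have hB (j : Fin (c.β + 1)) : c.meanBackoff p j =
      c.meanCounter j + p * c.meanBackoff p (c.nextStage j) := by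
    rw [val_nextStage, meanBackoff_min, ← c.meanBackoff_eq hp]
  have h0 : c.meanBackoff p ((0 : Fin (c.β + 1)) : ℕ) = c.meanBackoff p 0 := rfl
  rw [Finset.sum_mul]
  have h' : ∑ i, (T i * (1 + c.meanCounter i) - T i * (1 + (1 - p) * c.meanBackoff p 0)) =
      ∑ i, (T i * c.meanBackoff p i -
        T i * (p * c.meanBackoff p (c.nextStage i) + (1 - p) * c.meanBackoff p 0)) := by
    refine Finset.sum_congr rfl fun j _ => ?_
    rw [hB j]
    ring
  rw [Finset.sum_sub_distrib, Finset.sum_sub_distrib, h, h0, sub_self] at h'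
  linarith

lemma tsum_drawTail {a : ℝ} (ha : 0 ≤ a) (i : ℕ) :
    ∑' n, ENNReal.ofReal (a * c.drawTail i n) = ENNReal.ofReal (a * (1 + c.meanCounter i)) := by
  rw [tsum_eq_sum (s := Finset.range (c.cw i + 1)), ← ENNReal.ofReal_sum_of_nonneg
    fun n _ => mul_nonneg ha (c.drawTail_nonneg i n), ← Finset.mul_sum, sum_drawTail]
  intro n hn
  rw [Finset.mem_range, not_lt] at hn
  rw [c.drawTail_eq_zero hn, mul_zero, ENNReal.ofReal_zero]

/-- Both sides obey the same recursion in `n`, so their difference is constant. It is `0` because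
both tend to `0`, the point masses by summability. -/
lemma eq_mul_drawTail {π : Measure c.State} [IsProbabilityMeasure π] {a : ℝ} {i : Fin (c.β + 1)}
    (h : ∀ n, π.real {(i, n)} = π.real {(i, n + 1)} + a * c.drawProb i n) (n : ℕ) :
    π.real {(i, n)} = a * c.drawTail i n := by
  have hconst (n : ℕ) : π.real {(i, n)} - a * c.drawTail i n =
      π.real {(i, 0)} - a * c.drawTail i 0 := by
    induction n with
    | zero => rfl
    | succ n ih => rw [← ih, h n, c.drawTail_eq i n]; ring
  have hlim : Filter.Tendsto (fun n => π.real {(i, n)} - a * c.drawTail i n) Filter.atTop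
      (nhds (0 - 0)) := by
    refine .sub ?_ ?_
    · have hsum : ∑' n : ℕ, π {(i, n)} ≠ ∞ := by
        rw [← measure_iUnion (fun m n hmn => by simpa using hmn) fun _ => measurableSet_singleton _]
        exact measure_ne_top _ _
      have := (ENNReal.tendsto_toReal ENNReal.zero_ne_top).comp
        (ENNReal.tendsto_atTop_zero_of_tsum_ne_top hsum)
      rw [ENNReal.toReal_zero] at this
      exact this
    · refine tendsto_const_nhds.congr' ?_
      filter_upwards [Filter.eventually_gt_atTop (c.cw i)] with n hn
      rw [c.drawTail_eq_zero hn, mul_zero]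
  simp only [hconst] at hlim
  have h0 := tendsto_nhds_unique hlim tendsto_const_nhds
  have := hconst n
  linarith

lemma measureReal_counter_zero (π : Measure c.State) [IsFiniteMeasure π] :
    π.real {x | x.2 = 0} = ∑ i, π.real {(i, 0)} := by
  have h : {x : c.State | x.2 = 0} = ⋃ i, {(i, 0)} := by
    ext ⟨i, n⟩
    simp [eq_comm]
  rw [h, measureReal_iUnion_fintype (fun i j hij => by simpa using hij)
    fun _ => measurableSet_singleton _]

lemma one_le_meanCounter (i : ℕ) : 1 ≤ c.meanCounter i := by
  have : (1 : ℝ) ≤ c.cw i := by exact_mod_cast c.cw_pos i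
  unfold meanCounter; linarith

lemma IsCollisionProb.balance_eq_two {p : unitInterval} (h : c.IsCollisionProb p) :
    (p : ℝ) ≤ 1 / 2 ∧ c.balance p = 2 := by
  obtain ⟨π, hπ, hs, hp⟩ := h
  rw [isStationary_iff] at hs
  have hg i n := c.eq_mul_drawTail (hs i) n
  set T : Fin (c.β + 1) → ℝ := fun j => π.real {(j, 0)}
  have hT0 j : 0 ≤ T j := measureReal_nonneg
  have hT i : c.entryRate p T i = T i := by
    have := hg i 0
    rw [drawTail, if_pos rfl, mul_one] at this
    exact this.symm
  simp only [hT] at hg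
  have hτ : (p : ℝ) = ∑ i, T i := by
    rw [← measureReal_counter_zero]
    simpa using hp
  have hmass : ∑ i, T i * (1 + c.meanCounter i) = 1 := by
    have h1 : ∑' x, π {x} = 1 := by
      have := lintegral_countable' (μ := π) fun _ => 1
      simpa using this.symm
    have h2 (i : Fin (c.β + 1)) : ∑' n, π {(i, n)} =
        ENNReal.ofReal (T i * (1 + c.meanCounter i)) := by
      rw [← c.tsum_drawTail (hT0 i)]
      refine tsum_congr fun n => ?_
      rw [← hg i n, measureReal_def, ENNReal.ofReal_toReal (measure_ne_top _ _)]
    rw [ENNReal.tsum_prod', tsum_fintype] at h1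
    simp only [h2] at h1
    rw [← ENNReal.ofReal_sum_of_nonneg fun i _ => mul_nonneg (hT0 i)
      (add_nonneg zero_le_one (c.meanCounter_pos _).le), ENNReal.ofReal_eq_one] at h1
    exact h1
  -- Counters are drawn from `1` on, so each transmission is followed by a silent slot of the user.
  -- This excludes `p = 1`, where the formulas divide by zero.
  have hhalf : (p : ℝ) ≤ 1 / 2 := by
    have : ∑ i, T i * 2 ≤ ∑ i, T i * (1 + c.meanCounter i) :=
      Finset.sum_le_sum fun i _ => mul_le_mul_of_nonneg_left
        (by linarith [c.one_le_meanCounter i]) (hT0 i)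
    rw [← Finset.sum_mul] at this
    linarith
  refine ⟨hhalf, ?_⟩
  have hp1 : (p : ℝ) ≠ 1 := by linarith
  rw [c.balance_eq hp1]
  rw [c.sum_mul_meanCounter hp1 hT, ← hτ] at hmass
  linarith

/-- The stationary distribution of the backoff stage of the next transmission. -/
def stageLaw (p : ℝ) (i : ℕ) : ℝ := if i < c.β then p ^ i * (1 - p) else p ^ c.β

lemma sum_stageLaw (p : ℝ) : ∑ i : Fin (c.β + 1), c.stageLaw p i = 1 := by
  rw [Fin.sum_univ_eq_sum_range (c.stageLaw p), Finset.sum_range_succ]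
  have h : ∑ i ∈ Finset.range c.β, c.stageLaw p i = ∑ i ∈ Finset.range c.β, p ^ i * (1 - p) :=
    Finset.sum_congr rfl fun i hi => if_pos (Finset.mem_range.1 hi)
  rw [h, ← Finset.sum_mul, geom_sum_mul_neg, stageLaw, if_neg (lt_irrefl _)]
  ring

lemma entryRate_stageLaw (p : ℝ) (i : Fin (c.β + 1)) :
    c.entryRate p (fun j => c.stageLaw p j) i = c.stageLaw p i := by
  have h : c.entryRate p (fun j => c.stageLaw p j) i =
      (∑ j : Fin (c.β + 1), c.stageLaw p j * if min ((j : ℕ) + 1) c.β = i then p else 0) +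
        if (i : ℕ) = 0 then 1 - p else 0 := by
    simp only [entryRate, stageProb, mul_add, Finset.sum_add_distrib, ← Finset.sum_mul,
      sum_stageLaw, one_mul, Fin.ext_iff, val_nextStage, Fin.val_zero, @eq_comm _ 0 (i : ℕ)]
  rw [h, Fin.sum_univ_eq_sum_range (fun j => c.stageLaw p j * if min (j + 1) c.β = i then p else 0),
    Finset.sum_range_succ]
  have hi := Nat.lt_succ_iff.1 i.2
  generalize (i : ℕ) = k at hi
  have h' : ∑ j ∈ Finset.range c.β, c.stageLaw p j * (if min (j + 1) c.β = k then p else 0) =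
      ∑ j ∈ Finset.range c.β, if j + 1 = k then p ^ (j + 1) * (1 - p) else 0 := by
    refine Finset.sum_congr rfl fun j hj => ?_
    rw [Finset.mem_range] at hj
    rw [stageLaw, if_pos hj, min_eq_left (by omega)]
    split_ifs <;> ring
  rw [h', min_eq_right (by omega)]
  cases k with
  | zero =>
    simp only [stageLaw, Nat.succ_ne_zero, if_false, Finset.sum_const_zero, lt_irrefl, if_true]
    split_ifs with h1 h2 h2
    · omega
    · simp [h1]
    · simp
    · omega
  | succ k =>
    simp only [add_left_inj, Finset.sum_ite_eq', Finset.mem_range, Nat.succ_ne_zero, if_false,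
      stageLaw, lt_irrefl, add_zero, show k < c.β from hi, if_true]
    split_ifs with h1 h2 h2
    · omega
    · rw [← h1]; ring
    · ring
    · omega

/-- The weights have the form forced by `eq_mul_drawTail`, with stage rates `p * stageLaw p i`;
`balance p = 2` says precisely that their total mass is `1`. -/
lemma isCollisionProb_of_balance {p : unitInterval} (h : c.balance p = 2) :
    c.IsCollisionProb p := by
  have hp0 : (0 : ℝ) ≤ p := p.2.1
  have hp1 : (p : ℝ) ≠ 1 := by
    intro h1
    rw [h1] at h
    have hC := c.one_le_CWmin
    have hS : 0 ≤ ∑ i ∈ Finset.range c.β, (2 * (1 : ℝ)) ^ i :=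
      Finset.sum_nonneg fun i _ => by positivity
    have := mul_nonneg (zero_le_one.trans hC) hS
    simp only [balance, one_mul] at *
    linarith
  have hp1' : (0 : ℝ) ≤ 1 - p := sub_nonneg.2 p.2.2
  let T (i : Fin (c.β + 1)) : ℝ := p * c.stageLaw p i
  have hT0 i : 0 ≤ T i := by
    simp only [T, stageLaw]; split_ifs <;> positivity
  have hT i : c.entryRate p T i = T i := by
    have : c.entryRate p T i = p * c.entryRate p (fun j => c.stageLaw p j) i := by
      simp only [entryRate, T, Finset.mul_sum, mul_assoc]
    rw [this, entryRate_stageLaw]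
  have hτ : ∑ i, T i = p := by rw [← Finset.mul_sum, sum_stageLaw, mul_one]
  let w (x : c.State) : ℝ≥0∞ := ENNReal.ofReal (T x.1 * c.drawTail x.1 x.2)
  have hw : HasSum w 1 := by
    have : ∑' x, w x = 1 := by
      rw [ENNReal.tsum_prod', tsum_fintype]
      simp only [w, c.tsum_drawTail (hT0 _)]
      rw [← ENNReal.ofReal_sum_of_nonneg fun i _ => mul_nonneg (hT0 i)
        (add_nonneg zero_le_one (c.meanCounter_pos _).le), c.sum_mul_meanCounter hp1 hT, hτ,
        ENNReal.ofReal_eq_one]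
      rw [c.balance_eq hp1] at h
      linarith
    exact this ▸ ENNReal.summable.hasSum
  let π : PMF c.State := ⟨w, hw⟩
  have hπ i n : π.toMeasure.real {(i, n)} = T i * c.drawTail i n := by
    rw [measureReal_def, PMF.toMeasure_apply_singleton _ _ (measurableSet_singleton _)]
    exact ENNReal.toReal_ofReal (mul_nonneg (hT0 i) (c.drawTail_nonneg _ _))
  have hπ0 i : π.toMeasure.real {(i, 0)} = T i := by rw [hπ, drawTail, if_pos rfl, mul_one]
  refine ⟨π.toMeasure, inferInstance, ?_, ?_⟩
  · rw [isStationary_iff]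
    intro i n
    simp only [hπ0]
    rw [hT, hπ, hπ, c.drawTail_eq, mul_add]
  · rw [measureReal_counter_zero]
    simp only [hπ0, hτ]
    ring

lemma isCollisionProb_iff (p : unitInterval) : c.IsCollisionProb p ↔ c.balance p = 2 :=
  ⟨fun h => h.balance_eq_two.2, c.isCollisionProb_of_balance⟩

end CSMA

end

noncomputable section

namespace CSMA

variable {c : CSMA}

open scoped ENNReal

/-! ### Cycle times and inter-transmissions of the CSMA/CA channel -/

lemma cycleTime_eq_toReal {u : Fin 2} {ω : ℕ → c.Noise}
    (h : {t | Channel.IsRefresh (c.trace u ω) u t}.Infinite) (k : ℕ) :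
    c.cycleTime u k ω = (Channel.after (Channel.refreshAt u k)
      ({e | Channel.OtherFirst u e}.indicator
        (Channel.refreshCost (fun x => ENNReal.ofReal (c.slotCost x)) u)) (c.trace u ω)).toReal := by
  rw [Channel.after_refreshAt h]
  obtain ⟨n, hn, hcost⟩ := Channel.refreshCost_shift_refreshSlot
    (f := fun x => ENNReal.ofReal (c.slotCost x)) h k
  rw [hcost, ← ENNReal.ofReal_sum_of_nonneg fun _ _ => c.slotCost_nonneg _,
    ENNReal.toReal_ofReal (Finset.sum_nonneg fun _ _ => c.slotCost_nonneg _), cycleTime,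
    Channel.cycleEnd_refreshSlot h]
  have h0 : c.trace u ω (Channel.refreshSlot (c.trace u ω) u k) = .success u :=
    (Nat.nth_mem_of_infinite h k).1
  have h1 : c.trace u ω (Channel.refreshSlot (c.trace u ω) u (k + 1)) = .success u :=
    (Nat.nth_mem_of_infinite h (k + 1)).1
  have hend := c.endTime_add (c.trace u ω) (Channel.refreshSlot (c.trace u ω) u k) (n + 1)
  -- Both ends are successes of `u`, so the two trailing spaces equal `difs` and cancel.
  rw [← hn, h0, h1] at hend
  linarith

/-- The states do not depend on `u`; exchanging the users merely relabels the successes. Hence one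
law serves both users. -/
lemma precedingOthers_trace (u : Fin 2) (ω : ℕ → c.Noise) :
    Channel.precedingOthers u (c.trace u ω) = Channel.precedingOthers 0 (c.trace 0 ω) := by
  simp only [Channel.precedingOthers, ne_eq, trace_eq_success_self_iff]
  simp only [← ne_eq, trace_eq_success_other_iff]

section

variable {p : unitInterval} (hp0 : p ≠ 0) (hp1 : (p : ℝ) ≠ 1)
include hp0 hp1

lemma ae_infinite_isRefresh (u : Fin 2) :
    ∀ᵐ ω ∂(c.law p), {t | Channel.IsRefresh (c.trace u ω) u t}.Infinite :=
  ae_of_ae_map (c.measurable_trace u).aemeasurable ((c.isRenewal_traceLaw u p).ae_infinite_refresh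
    (lintegral_successCost_one_ne_top c u hp1) (c.traceLaw_otherFirst_ne_zero u hp0))

/-- The cycle times are integrable, and their mean is the mean time between two successes of the
user, divided by the probability that the other user succeeds in between. -/
lemma integrable_cycleTime_and_integral (u : Fin 2) (k : ℕ) :
    Integrable (c.cycleTime u k) (c.law p) ∧ ∫ ω, c.cycleTime u k ω ∂(c.law p) =
      (waitCost u p c.slotCost * c.meanBackoff p 0 + accessCost u p c.slotCost / (1 - p)) /
        (c.traceLaw u p).real {e | Channel.OtherFirst u e} := by
  have hm := c.measurable_trace u
  have h1 := lintegral_successCost_one_ne_top c u hp1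
  have hD := c.traceLaw_otherFirst_ne_zero u hp0
  have hcost := lintegral_successCost_ofReal c u (g := c.slotCost) hp1 c.slotCost_nonneg
  have hmean := (c.isRenewal_traceLaw u p).lintegral_after_refreshAt
    (f := fun x => ENNReal.ofReal (c.slotCost x)) h1 hD (hcost ▸ ENNReal.ofReal_ne_top) k
  set Φ := Channel.after (Channel.refreshAt u k) ({e | Channel.OtherFirst u e}.indicator
    (Channel.refreshCost (fun x => ENNReal.ofReal (c.slotCost x)) u))
  have hΦ : Measurable Φ := (Channel.isSuccessTime_refreshAt u k).measurable_after
    ((Channel.measurable_refreshCost _ u).indicator (Channel.measurableSet_otherFirst u))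
  have hΦm : Measurable fun ω => Φ (c.trace u ω) := hΦ.comp hm
  rw [hcost, traceLaw, lintegral_map hΦ hm] at hmean
  have hfin : ∫⁻ ω, Φ (c.trace u ω) ∂(c.law p) ≠ ∞ := by
    rw [hmean]
    exact ENNReal.div_ne_top ENNReal.ofReal_ne_top hD
  have hae : c.cycleTime u k =ᵐ[c.law p] fun ω => (Φ (c.trace u ω)).toReal := by
    filter_upwards [ae_infinite_isRefresh hp0 hp1 u] with ω hω using cycleTime_eq_toReal hω k
  refine ⟨(integrable_toReal_of_lintegral_ne_top hΦm.aemeasurable hfin).congr hae.symm, ?_⟩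
  rw [integral_congr_ae hae, integral_toReal hΦm.aemeasurable (ae_lt_top hΦm hfin), hmean,
    ENNReal.toReal_div, ENNReal.toReal_ofReal, measureReal_def, traceLaw]
  exact add_nonneg (mul_nonneg (waitCost_nonneg c.slotCost_nonneg)
    (c.meanBackoff_nonneg p.2.1 p.2.2 _))
    (div_nonneg (accessCost_nonneg c.slotCost_nonneg) (sub_nonneg.2 p.2.2))

omit hp0 in
lemma measureReal_interTrans (u : Fin 2) (j n : ℕ) :
    (c.law p).real {ω | Channel.interTrans (c.trace u ω) u j = n} =
      (c.law p).real {ω | Channel.precedingOthers 0 (c.trace 0 ω) = n} := by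
  have h1 := lintegral_successCost_one_ne_top c u hp1
  have hm := (c.measurable_trace u).aemeasurable (μ := c.law p)
  obtain ⟨hnull, heq⟩ := (c.isRenewal_traceLaw u p).measure_interTrans h1 j n
  rw [traceLaw, Measure.map_apply₀ hm hnull, Measure.map_apply₀ hm
    (Channel.nullMeasurableSet_precedingOthers (Channel.ae_exists_success h1) n)] at heq
  simp only [← precedingOthers_trace u]
  exact congrArg ENNReal.toReal heq

omit hp0 in
lemma measureReal_otherFirst (u : Fin 2) :
    (c.traceLaw u p).real {e | Channel.OtherFirst u e} =
      1 - (c.law p).real {ω | Channel.precedingOthers 0 (c.trace 0 ω) = 0} := by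
  have h1 := lintegral_successCost_one_ne_top c u hp1
  have hm := (c.measurable_trace u).aemeasurable (μ := c.law p)
  have hD := Channel.measurableSet_otherFirst u
  have hae : ({e | Channel.precedingOthers u e = 0} : Set (ℕ → SlotOutcome (Fin 2))) =ᵐ[
      c.traceLaw u p] ({e | Channel.OtherFirst u e}ᶜ : Set (ℕ → SlotOutcome (Fin 2))) := by
    refine Filter.eventuallyEq_set.2 ?_
    filter_upwards [Channel.ae_exists_success h1] with e he
    rw [Set.mem_compl_iff, Set.mem_ofPred_eq,
      Channel.otherFirst_iff_precedingOthers_ne_zero he, not_not]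
  have h2 := probReal_compl_eq_one_sub (μ := c.traceLaw u p) hD
  rw [← measureReal_congr hae, measureReal_def, traceLaw, Measure.map_apply₀ hm
    (Channel.nullMeasurableSet_precedingOthers (Channel.ae_exists_success h1) 0)] at h2
  simp only [← precedingOthers_trace u, measureReal_def, traceLaw] at h2 ⊢
  change ((c.law p) {ω | Channel.precedingOthers u (c.trace u ω) = 0}).toReal = _ at h2
  linarith

end

end CSMA

open CSMA in
theorem theorem2 (c : CSMA) (hCW : 2 ≤ c.CWmax) :
    -- the collision probability exists and is unique
    (∃! p : unitInterval, c.IsCollisionProb p) ∧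
    -- the recursive equation has a unique solution among probabilities
    (∃! p : unitInterval, c.SolvesRecursion p) ∧
    ∀ p : unitInterval, c.IsCollisionProb p →
      -- the collision probability satisfies the recursive equation
      c.SolvesRecursion p ∧
      -- almost surely, each user has infinitely many refresh moments, each starting one cycle
      (∀ u : Fin 2, ∀ᵐ ω ∂(c.law p),
        {t | Channel.IsRefresh (c.trace u ω) u t}.Infinite ∧
        ∀ t₀, Channel.IsRefresh (c.trace u ω) u t₀ → ∃! t₁, Channel.IsCycle (c.trace u ω) u t₀ t₁) ∧
      (∀ u k, Integrable (c.cycleTime u k) (c.law p)) ∧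
      ∃ P : ℕ → ℝ,
        -- `P n` is the probability of `n` inter-transmissions, for each user and at all times
        (∀ u j n, (c.law p).real {ω | Channel.interTrans (c.trace u ω) u j = n} = P n) ∧
        P 0 < 1 ∧
        -- the channel cycle time
        ∀ k, c.channelCycleTime p k =
          1 / (1 - P 0) *
            (c.difs + c.nav + c.tran + (c.difs + c.rcts) / (1 - p)
              + ∑ i ∈ Finset.range c.β, (p : ℝ) ^ i * (c.Tslot * ((1 + 2 ^ i * c.CWmin) / 2))
              + (p : ℝ) ^ c.β / (1 - p) * (c.Tslot * ((1 + 2 ^ c.β * c.CWmin) / 2))) := by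
  have hrec (p : unitInterval) := c.solvesRecursion_iff hCW p.2.1
  simp only [hrec, isCollisionProb_iff]
  refine ⟨c.existsUnique_balance, c.existsUnique_balance, fun p hp => ⟨hp, ?_⟩⟩
  have hhalf := ((c.isCollisionProb_of_balance hp).balance_eq_two).1
  have hp0 : p ≠ 0 := by
    rintro rfl
    simp [balance] at hp
  have hp1 : (p : ℝ) ≠ 1 := by linarith
  have h1p : 1 - (p : ℝ) ≠ 0 := sub_ne_zero.2 hp1.symm
  refine ⟨fun u => ?_, fun u k => (integrable_cycleTime_and_integral hp0 hp1 u k).1,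
    fun n => (c.law p).real {ω | Channel.precedingOthers 0 (c.trace 0 ω) = n},
    measureReal_interTrans hp1, ?_, fun k => ?_⟩
  · filter_upwards [ae_infinite_isRefresh hp0 hp1 u] with ω hω
    exact ⟨hω, fun t₀ => Channel.existsUnique_isCycle hω⟩
  · have hpos : 0 < (c.traceLaw 0 p).real {e | Channel.OtherFirst 0 e} :=
      ENNReal.toReal_pos (c.traceLaw_otherFirst_ne_zero 0 hp0) (measure_ne_top _ _)
    rw [measureReal_otherFirst hp1] at hpos
    linarith
  -- `balance p = 2` reads p + (1 - p) p B = 1 with B the mean backoff; 1 - p then cancels.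
  · have hpB : (p : ℝ) * c.meanBackoff p 0 = 1 := by
      rw [c.balance_eq hp1] at hp
      refine mul_right_cancel₀ h1p ?_
      linarith
    have hB : ∑ i ∈ Finset.range c.β, (p : ℝ) ^ i * (c.Tslot * ((1 + 2 ^ i * c.CWmin) / 2)) +
        (p : ℝ) ^ c.β / (1 - p) * (c.Tslot * ((1 + 2 ^ c.β * c.CWmin) / 2)) =
        c.Tslot * c.meanBackoff p 0 := by
      rw [meanBackoff, Nat.sub_zero, mul_add, Finset.mul_sum, c.meanCounter_of_le le_rfl]
      refine congrArg₂ _ (Finset.sum_congr rfl fun i hi => ?_) (by ring)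
      rw [zero_add, c.meanCounter_of_le (Finset.mem_range.1 hi).le]
      ring
    rw [channelCycleTime, Fin.sum_univ_two, (integrable_cycleTime_and_integral hp0 hp1 0 k).2,
      (integrable_cycleTime_and_integral hp0 hp1 1 k).2, measureReal_otherFirst hp1,
      measureReal_otherFirst hp1, add_assoc (_ + _ / _), hB]
    simp only [waitCost, accessCost, slotCost, endTime.body, endTime.gap, nav]
    generalize 1 - (c.law p).real {ω | Channel.precedingOthers 0 (c.trace 0 ω) = 0} = q
    generalize c.meanBackoff p 0 = B at *
    -- By `hpB` the waiting part equals `rcts + tran + difs - Tslot + Tslot * B`, the source of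
    -- `nav`; the access part equals `tran + (difs + rcts) / (1 - p)`.
    have hcost : (p * (c.rcts + c.tran + c.difs) + (1 - p) * (c.Tslot + 0)) * B +
        (p * (c.rcts + c.difs) + (1 - p) * (c.rcts + c.tran + c.difs)) / (1 - p) =
        c.difs + (c.tran + c.rcts - c.Tslot) + c.tran + (c.difs + c.rcts) / (1 - p) +
          c.Tslot * B := by
      field_simp
      linear_combination (1 - (p : ℝ)) * (c.rcts + c.tran + c.difs - c.Tslot) * hpB
    rw [hcost]
    ring

end
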